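/- **Setting.** Let $\lambda\in(0,1]$. For a real $m\times d$ matrix $A$ with $d=\lambda m$, let $\rho_1,\dots,\rho_d\ge 0$ be the eigenvalues of $A^TA$ and let $\mu_A=\frac1{2d}\sum_{i=1}^d(\delta_{\sqrt{\rho_i}}+\delta_{-\sqrt{\rho_i}})$ be its symmetrized singular law. Put $R=\max_i\rho_i$, $X=[\sqrt R,\infty)^2$, and let $\mathcal G_\mu(x)=\int\frac{d\mu(u)}{x-u}$. *Free side* ($\mu=\mu_A$). - Let $H^\lambda_\mu(x)=\lambda\,\mathcal G_\mu(1/\sqrt x)^2+(1-\lambda)\sqrt x\,\mathcal G_\mu(1/\sqrt x)$ for $x\geq 0$ near $0$ (with $H^\lambda_\mu(0)=0$), let $[H^\lambda_\mu]^{-1}$ be its compositional inverse, and let $U^\lambda(x)=\frac{-\lambda-1+\sqrt{(\lambda+1)^2+4\lambda x}}{2\lambda}$. The rectangular free $R$-transform is $\mathcal R^\lambda_\mu(x)=U^\lambda\big(\tfrac{x}{[H^\lambda_\mu]^{-1}(x)}-1\big)$. - Let $\mathcal H_\mu(x)=\mathcal G_\mu(x)\big(\lambda\mathcal G_\mu(x)+\frac{1-\lambda}{x}\big)$.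 This is a bijection from $(\sqrt R,\infty)$ onto $(0,\infty)$; write $\mathcal J_\mu$ for its inverse. *Finite side.* For $(x,y)\in X$ let $\Delta_\lambda^+(x,y,A)=y^{\frac{1-\lambda}{\sqrt\lambda}}\big[\det(xyI_d-A^TA)^{1/d}\big]^{\sqrt\lambda}$ and $F=-\log\Delta^+_\lambda(\cdot,\cdot,A)$. For $s>0$ put $z(s)=\mathcal J_{\mu_A}(s^2)$, $r(s)=-\partial_xF(z(s),z(s))$ and $t(s)=-\partial_yF(z(s),z(s))$. With $\|f\|_q=\big(\iint_Xf^q\,dx\,dy\big)^{1/q}$ define $$\mathcal Q_{A}^{d,\lambda}(s)=\frac{\partial}{\partial r}\log\|e^{-xr-yt}\Delta^+_\lambda(x,y,A)\|_{\sqrt{md}}\cdot\frac{\partial}{\partial t}\log\|e^{-xr-yt}\Delta^+_\lambda(x,y,A)\|_{\sqrt{md}}\Big|_{r=r(s),\,t=t(s)},$$ $$\mathcal K^{d,\lambda}_{A}(s)=\sqrt{\tfrac1\lambda s^2\mathcal Q^{d,\lambda}_{A}(s)+\tfrac{(1-\lambda)^2}{4\lambda^2}},\qquad \widetilde{\mathcal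 R}^{d,\lambda}_{A}(s)=\mathcal K^{d,\lambda}_{A}(s)-\mathcal K^{d,\lambda}_{0}(s),$$ where the index $0$ stands for the zero matrix of the same size $m\times d$ (so $\mu_0=\delta_0$). **Theorem (Convergence of the modified finite $R$-transform to the free $R$-transform).** Fix $\lambda\in(0,1]$ and a measure $\mu$, and let $A_n$ be real $m_n\times d_n$ matrices with $d_n=\lambda m_n$, $d_n\to\infty$, and $\mu_{A_n}=\mu$ for all $n$. Then $\mathcal R^\lambda_\mu$ has a power series expansion: there are real coefficients $(a_k)_{k\ge0}$ with $\mathcal R^\lambda_\mu(x)=\sum_k a_kx^k$ for all small $x>0$. For every $s>0$ such that $\sum_k a_ks^{2k}$ converges absolutely (in particular for all small $s>0$), this series has sum $\mathcal R^\lambda_\mu(s^2)$ and $$\lim_{n\to\infty}\widetilde{\mathcal R}^{d_n,\lambda}_{A_n}(s)=\mathcal R^\lambda_{\mu}(s^2).$$ Here, for $s^2$ beyond a small neighbourhood of $0$, $[H^\lambda_\mu]^{-1}$ is the inverse of $H^\lambda_\mu$ restricted to $\{x\ge0:\ xR<1\}$, which is mapped bijectively onto $[0,\infty)$. -/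

import Mathlib

open MeasureTheory Filter Topology Set
open scoped Matrix

namespace RectFree

noncomputable section

/-! ### The free side: transforms of a (compactly supported, symmetric) measure on the line -/

/-- Cauchy transform `G_μ(x) = ∫ dμ(t) / (x - t)`, for real `x` above the support of `μ`. -/
def cauchyTransform (μ : Measure ℝ) (x : ℝ) : ℝ :=
  ∫ t, 1 / (x - t) ∂μ

/-- Largest point of the support of `μ`.  For the symmetrized singular law of a matrix `A` this is
`√R`, where `R` is the largest root of the characteristic polynomial of `Aᵀ A`. -/
def edge (μ : Measure ℝ) : ℝ :=
  sSup μ.support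

/-- The rectangular Cauchy transform in the variable at `0`:
`H(x) = λ G_μ(1/√x)² + (1-λ) √x G_μ(1/√x)`. -/
def rectH (lam : ℝ) (μ : Measure ℝ) (x : ℝ) : ℝ :=
  lam * cauchyTransform μ (1 / √x) ^ 2 + (1 - lam) * √x * cauchyTransform μ (1 / √x)

/-- Compositional inverse of `H` : the inverse of its restriction to the interval
`0 ≤ x < 1 / edge² ` (all of `[0, ∞)` if `edge = 0`), on which `H` is a bijection onto `[0, ∞)`. -/
def rectHInv (lam : ℝ) (μ : Measure ℝ) : ℝ → ℝ :=
  Function.invFunOn (rectH lam μ) {x | 0 ≤ x ∧ x * edge μ ^ 2 < 1}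

/-- `U(x) = (-λ - 1 + ((λ+1)² + 4λx)^{1/2}) / (2λ)`. -/
def rectU (lam x : ℝ) : ℝ :=
  (-lam - 1 + √((lam + 1) ^ 2 + 4 * lam * x)) / (2 * lam)

/-- The rectangular free `R`-transform `U(x / H⁻¹(x) - 1)`, for `x > 0`.
(The value at the removable singularity `x = 0` is not used.) -/
def rectR (lam : ℝ) (μ : Measure ℝ) (x : ℝ) : ℝ :=
  rectU lam (x / rectHInv lam μ x - 1)

/-- The rectangular Cauchy transform in the variable at infinity:
`x ↦ G_μ(x) (λ G_μ(x) + (1-λ) / x)`, for `x > edge μ`. -/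
def rectCauchy (lam : ℝ) (μ : Measure ℝ) (x : ℝ) : ℝ :=
  cauchyTransform μ x * (lam * cauchyTransform μ x + (1 - lam) * (1 / x))

/-- The inverse of the bijection `rectCauchy : (edge μ, ∞) → (0, ∞)`. -/
def rectCauchyInv (lam : ℝ) (μ : Measure ℝ) : ℝ → ℝ :=
  Function.invFunOn (rectCauchy lam μ) (Ioi (edge μ))

/-! ### The finite side -/

variable {m d : ℕ}

/-- Symmetrized singular law of an `m × d` matrix:
`(1/2d) ∑ᵢ (δ_{√ρᵢ} + δ_{-√ρᵢ})`, with `ρᵢ` the eigenvalues of `Aᵀ A`. -/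
def symmSingularLaw (A : Matrix (Fin m) (Fin d) ℝ) : Measure ℝ :=
  (2 * (d : ENNReal))⁻¹ •
    ∑ i, (Measure.dirac (√((Matrix.isHermitian_conjTranspose_mul_self A).eigenvalues i)) +
      Measure.dirac (-√((Matrix.isHermitian_conjTranspose_mul_self A).eigenvalues i)))

/-- Normalized determinant `det(M)^{1/d}` of a `d × d` matrix. -/
def fkDet (M : Matrix (Fin d) (Fin d) ℝ) : ℝ :=
  M.det ^ (1 / (d : ℝ))

/-- Bivariate rectangular Fuglede–Kadison determinant
`y^{(1-λ)/√λ} [det(x y I - Aᵀ A)^{1/d}]^{√λ}`. -/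
def rectFK (lam : ℝ) (A : Matrix (Fin m) (Fin d) ℝ) (x y : ℝ) : ℝ :=
  y ^ ((1 - lam) / √lam) *
    fkDet ((x * y) • (1 : Matrix (Fin d) (Fin d) ℝ) - Aᵀ * A) ^ √lam

/-- Fuglede–Kadison potential. -/
def fkPotential (lam : ℝ) (A : Matrix (Fin m) (Fin d) ℝ) (x y : ℝ) : ℝ :=
  -Real.log (rectFK lam A x y)

/-- The point `z(s) = J(s²)`. -/
def zPoint (lam : ℝ) (A : Matrix (Fin m) (Fin d) ℝ) (s : ℝ) : ℝ :=
  rectCauchyInv lam (symmSingularLaw A) (s ^ 2)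

/-- `r(s) = -∂ₓ F(z(s), z(s))`. -/
def rPoint (lam : ℝ) (A : Matrix (Fin m) (Fin d) ℝ) (s : ℝ) : ℝ :=
  -deriv (fun x => fkPotential lam A x (zPoint lam A s)) (zPoint lam A s)

/-- `t(s) = -∂_y F(z(s), z(s))`. -/
def tPoint (lam : ℝ) (A : Matrix (Fin m) (Fin d) ℝ) (s : ℝ) : ℝ :=
  -deriv (fun y => fkPotential lam A (zPoint lam A s) y) (zPoint lam A s)

/-- `L_q`-norm of a nonnegative function on a planar domain `X`. -/
def lqNorm (X : Set (ℝ × ℝ)) (q : ℝ) (f : ℝ → ℝ → ℝ) : ℝ :=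
  (∫ v in X, f v.1 v.2 ^ q) ^ (1 / q)

/-- The quadrant `X = [√R, ∞) × [√R, ∞)`. -/
def quadrant (A : Matrix (Fin m) (Fin d) ℝ) : Set (ℝ × ℝ) :=
  Ici (edge (symmSingularLaw A)) ×ˢ Ici (edge (symmSingularLaw A))

/-- `log ‖e^{-xr-yt} Δ(x, y)‖_{√(md)}` as a function of `(r, t)`. -/
def logNorm (lam : ℝ) (A : Matrix (Fin m) (Fin d) ℝ) (r t : ℝ) : ℝ :=
  Real.log (lqNorm (quadrant A) (√((m : ℝ) * d))
    (fun x y => Real.exp (-x * r - y * t) * rectFK lam A x y))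

/-- The finite inverse rectangular transform: the product of the two partial derivatives of
`logNorm` at `(r(s), t(s))`. -/
def finiteQ (lam : ℝ) (A : Matrix (Fin m) (Fin d) ℝ) (s : ℝ) : ℝ :=
  deriv (fun r => logNorm lam A r (tPoint lam A s)) (rPoint lam A s) *
    deriv (fun t => logNorm lam A (rPoint lam A s) t) (tPoint lam A s)

/-- `K(s) = ((1/λ) s² Q(s) + (1-λ)²/(4λ²))^{1/2}`. -/
def finiteK (lam : ℝ) (A : Matrix (Fin m) (Fin d) ℝ) (s : ℝ) : ℝ :=
  √(1 / lam * s ^ 2 * finiteQ lam A s + (1 - lam) ^ 2 / (4 * lam ^ 2))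

/-- The modified rectangular finite `R`-transform `K_{μ_A}(s) - K_{μ_0}(s)`, where `μ_0 = δ₀` is the
singular law of the zero matrix of the same size. -/
def modifiedR (lam : ℝ) (A : Matrix (Fin m) (Fin d) ℝ) (s : ℝ) : ℝ :=
  finiteK lam A s - finiteK lam (0 : Matrix (Fin m) (Fin d) ℝ) s

end

end RectFree

/-! Everything is governed by one function. With `w = 1/x²` and `M(w) = ∫ (1 - w u²)⁻¹ dμ(u)`, the
Cauchy transform is `M(w)/x`, and both rectangular transforms equal `w P(w)` with `P = λ M² + (1-λ)
M`. Since `P ≥ 1` is nondecreasing and blows up at the edge, `w P(w)` is an increasing bijection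
onto `[0, ∞)`. Hence `[H]⁻¹(s²) = 1/z(s)²` (`rectCauchyInv_spec`) and the free transform at `s²` is
`U(P - 1)` with `P = s² z(s)²` (`rectR_eq`).

On the finite side put `q = √(md) = d/√λ`, which tends to infinity. The two derivatives of the
log-norm are minus the means of `x` and `y` under the Gibbs weight `exp(-q (x r + y t - log Δ))`
(`deriv_logNorm`). As `(r, t)` is the gradient of `log Δ` at `(z, z)` and `log Δ` lies below its
tangent plane there with an explicit gap (`sub_one_sub_log_le`), Laplace's method sends both means
to `z` (`tendsto_gibbs_mean`), so `Q → z²`. Completing the square gives `K → U(P - 1) + (λ+1)/(2λ)`.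
The zero matrix has `P = 1`, so its `K` tends to `(λ+1)/(2λ)`, and the difference tends to the free
transform, for every `s > 0`.

The series comes from the analytic inverse function theorem at `0`. Analyticity of the free
transform on `(0, ∞)` and the identity theorem carry its sum to every point of absolute convergence
(`hasSum_of_summable_of_analyticOnNhd`). -/

namespace RectFree

noncomputable section

/-! ### Symmetric atomic laws -/

/-- The symmetric law `(1/2N) ∑ᵢ (δ_{√ρᵢ} + δ_{-√ρᵢ})` with squared atoms `ρᵢ`. -/
def symmAtomicLaw {N : ℕ} (ρ : Fin N → ℝ) : Measure ℝ :=
  (2 * (N : ENNReal))⁻¹ • ∑ i, (Measure.dirac (√(ρ i)) + Measure.dirac (-√(ρ i)))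

lemma integral_symmAtomicLaw {N : ℕ} (ρ : Fin N → ℝ) (f : ℝ → ℝ) :
    ∫ u, f u ∂(symmAtomicLaw ρ) = (∑ i, (f (√(ρ i)) + f (-√(ρ i)))) / (2 * N) := by
  have hint : ∀ i ∈ (Finset.univ : Finset (Fin N)),
      Integrable f (Measure.dirac (√(ρ i)) + Measure.dirac (-√(ρ i))) := fun i _ =>
    (integrable_dirac (by simp)).add_measure (integrable_dirac (by simp))
  rw [symmAtomicLaw, integral_smul_measure, integral_finsetSum_measure hint]
  have : ∀ i, ∫ u, f u ∂(Measure.dirac (√(ρ i)) + Measure.dirac (-√(ρ i)))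
      = f (√(ρ i)) + f (-√(ρ i)) := fun i => by
    rw [integral_add_measure (integrable_dirac (by simp)) (integrable_dirac (by simp)),
      integral_dirac, integral_dirac]
  simp only [this, ENNReal.toReal_inv, ENNReal.toReal_mul, ENNReal.toReal_ofNat,
    ENNReal.toReal_natCast, smul_eq_mul]
  rw [div_eq_inv_mul]

lemma sqrt_mem_support_symmAtomicLaw {N : ℕ} (ρ : Fin N → ℝ) (i : Fin N) :
    √(ρ i) ∈ (symmAtomicLaw ρ).support := by
  rw [Measure.mem_support_iff_forall]
  intro U hU
  have h1 : (1 : ENNReal) ≤ Measure.dirac (√(ρ i)) U := by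
    rw [Measure.dirac_apply_of_mem (mem_of_mem_nhds hU)]
  have h2 : (1 : ENNReal) ≤
      (∑ j, (Measure.dirac (√(ρ j)) + Measure.dirac (-√(ρ j)))) U := by
    rw [Measure.finsetSum_apply]
    refine le_trans ?_ (Finset.single_le_sum (f := fun j =>
      (Measure.dirac (√(ρ j)) + Measure.dirac (-√(ρ j)) : Measure ℝ) U)
      (fun _ _ => zero_le) (Finset.mem_univ i))
    exact h1.trans (by simp)
  rw [symmAtomicLaw, Measure.smul_apply, smul_eq_mul]
  refine ENNReal.mul_pos ?_ (lt_of_lt_of_le zero_lt_one h2).ne'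
  simp [ENNReal.mul_eq_top]

lemma support_symmAtomicLaw_subset {N : ℕ} (ρ : Fin N → ℝ) :
    (symmAtomicLaw ρ).support ⊆
      range (fun i => √(ρ i)) ∪ range (fun i => -√(ρ i)) := by
  refine Measure.support_subset_of_isClosed
    ((finite_range _).union (finite_range _)).isClosed ?_
  rw [mem_ae_iff, symmAtomicLaw, Measure.smul_apply, Measure.finsetSum_apply]
  rw [Finset.sum_eq_zero, smul_zero]
  intro i _
  have hm : MeasurableSet (range (fun i => √(ρ i)) ∪ range (fun i => -√(ρ i)))ᶜ :=
    ((finite_range _).union (finite_range _)).measurableSet.compl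
  rw [Measure.add_apply, Measure.dirac_apply' _ hm, Measure.dirac_apply' _ hm]
  simp

lemma bddAbove_support_symmAtomicLaw {N : ℕ} (ρ : Fin N → ℝ) :
    BddAbove (symmAtomicLaw ρ).support :=
  (((finite_range _).union (finite_range _)).subset (support_symmAtomicLaw_subset ρ)).bddAbove

lemma sqrt_le_edge {N : ℕ} (ρ : Fin N → ℝ) (i : Fin N) :
    √(ρ i) ≤ edge (symmAtomicLaw ρ) :=
  le_csSup (bddAbove_support_symmAtomicLaw ρ) (sqrt_mem_support_symmAtomicLaw ρ i)

lemma edge_nonneg {N : ℕ} (ρ : Fin N → ℝ) (hN : 0 < N) : 0 ≤ edge (symmAtomicLaw ρ) :=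
  (Real.sqrt_nonneg _).trans (sqrt_le_edge ρ ⟨0, hN⟩)

lemma le_edge_sq {N : ℕ} {ρ : Fin N → ℝ} (hρ : ∀ i, 0 ≤ ρ i) (i : Fin N) :
    ρ i ≤ edge (symmAtomicLaw ρ) ^ 2 := by
  rw [← Real.sq_sqrt (hρ i)]
  exact pow_le_pow_left₀ (Real.sqrt_nonneg _) (sqrt_le_edge ρ i) 2

/-- An atom sits exactly at the edge; this is what makes `M(w)` blow up as `w` tends to `1/edge²`.
-/
lemma exists_eq_edge_sq {N : ℕ} {ρ : Fin N → ℝ} (hN : 0 < N) (hρ : ∀ i, 0 ≤ ρ i) :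
    ∃ i, ρ i = edge (symmAtomicLaw ρ) ^ 2 := by
  have : Nonempty (Fin N) := ⟨⟨0, hN⟩⟩
  obtain ⟨i, hi⟩ := Finite.exists_max ρ
  refine ⟨i, le_antisymm (le_edge_sq hρ i) ?_⟩
  have h : edge (symmAtomicLaw ρ) ≤ √(ρ i) := by
    refine csSup_le ⟨_, sqrt_mem_support_symmAtomicLaw ρ i⟩ fun b hb => ?_
    rcases support_symmAtomicLaw_subset ρ hb with ⟨j, rfl⟩ | ⟨j, rfl⟩
    · exact Real.sqrt_le_sqrt (hi j)
    · exact (neg_nonpos.2 (Real.sqrt_nonneg _)).trans (Real.sqrt_nonneg _)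
  calc _ ≤ √(ρ i) ^ 2 := pow_le_pow_left₀ (edge_nonneg ρ hN) h 2
    _ = ρ i := Real.sq_sqrt (hρ i)

lemma cauchyTransform_symmAtomicLaw {N : ℕ} {ρ : Fin N → ℝ} (hρ : ∀ i, 0 ≤ ρ i) {x : ℝ}
    (hx : 0 < x) (hx2 : ∀ i, ρ i < x ^ 2) :
    cauchyTransform (symmAtomicLaw ρ) x = (∑ i, x / (x ^ 2 - ρ i)) / N := by
  rw [cauchyTransform, integral_symmAtomicLaw]
  have : ∀ i, 1 / (x - √(ρ i)) + 1 / (x - -√(ρ i)) = 2 * (x / (x ^ 2 - ρ i)) := fun i => by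
    have h1 : √(ρ i) < x := (Real.sqrt_lt' hx).2 (hx2 i)
    have h2 := Real.sqrt_nonneg (ρ i)
    have h3 : x ^ 2 - ρ i = (x - √(ρ i)) * (x + √(ρ i)) := by
      linear_combination Real.sq_sqrt (hρ i)
    have h4 : x - √(ρ i) ≠ 0 := by linarith
    have h5 : x + √(ρ i) ≠ 0 := by linarith
    rw [h3, sub_neg_eq_add]
    field_simp
    ring
  simp only [this]
  rw [← Finset.mul_sum, mul_div_mul_left _ _ two_ne_zero]

/-- With `1/0 = 0`, the point `1/√x` at `x = 0` is `0`; the symmetric atoms cancel there, so `rectH`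
has the intended value `0`. -/
lemma cauchyTransform_symmAtomicLaw_zero {N : ℕ} (ρ : Fin N → ℝ) :
    cauchyTransform (symmAtomicLaw ρ) 0 = 0 := by
  rw [cauchyTransform, integral_symmAtomicLaw]
  simp [div_neg]

/-! ### The rectangular Cauchy transform in the squared variable at zero -/

variable {N : ℕ}

/-- `M(w) = ∫ (1 - w u²)⁻¹ dμ(u)`, so that `G_μ(x) = M(1/x²)/x`. -/
def momentFn (ρ : Fin N → ℝ) (w : ℝ) : ℝ := (∑ i, (1 - ρ i * w)⁻¹) / N

/-- The quotient `H(w)/w`. -/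
def rectP (lam : ℝ) (ρ : Fin N → ℝ) (w : ℝ) : ℝ :=
  lam * momentFn ρ w ^ 2 + (1 - lam) * momentFn ρ w

lemma cauchyTransform_eq_momentFn {ρ : Fin N → ℝ} (hρ : ∀ i, 0 ≤ ρ i) {x : ℝ}
    (hx : 0 < x) (hx2 : ∀ i, ρ i < x ^ 2) :
    cauchyTransform (symmAtomicLaw ρ) x = momentFn ρ (1 / x ^ 2) / x := by
  rw [cauchyTransform_symmAtomicLaw hρ hx hx2, momentFn, div_right_comm]
  congr 1
  rw [Finset.sum_div]
  refine Finset.sum_congr rfl fun i _ => ?_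
  have h1 : x ^ 2 - ρ i ≠ 0 := by linarith [hx2 i]
  have h2 : 1 - ρ i * (1 / x ^ 2) = (x ^ 2 - ρ i) / x ^ 2 := by field_simp
  rw [h2]
  field_simp

lemma rectH_eq {lam : ℝ} {ρ : Fin N → ℝ} (hρ : ∀ i, 0 ≤ ρ i) {w : ℝ} (hw : 0 ≤ w)
    (hw1 : w * edge (symmAtomicLaw ρ) ^ 2 < 1) :
    rectH lam (symmAtomicLaw ρ) w = w * rectP lam ρ w := by
  rcases hw.eq_or_lt with rfl | hw
  · simp [rectH, cauchyTransform_symmAtomicLaw_zero]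
  · have hs : 0 < √w := Real.sqrt_pos.2 hw
    have hsq : √w ^ 2 = w := Real.sq_sqrt hw.le
    have h : ∀ i, ρ i < (1 / √w) ^ 2 := fun i => by
      rw [div_pow, hsq, one_pow, lt_div_iff₀ hw]
      nlinarith [le_edge_sq hρ i]
    rw [rectH, cauchyTransform_eq_momentFn hρ (by positivity) h, rectP]
    have : 1 / (1 / √w) ^ 2 = w := by rw [div_pow, hsq]; simp
    rw [this, div_div_eq_mul_div, div_one]
    linear_combination (lam * momentFn ρ w ^ 2 + (1 - lam) * momentFn ρ w) * hsq

lemma rectCauchy_eq {lam : ℝ} {ρ : Fin N → ℝ} (hN : 0 < N) (hρ : ∀ i, 0 ≤ ρ i) {x : ℝ}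
    (hx : edge (symmAtomicLaw ρ) < x) :
    rectCauchy lam (symmAtomicLaw ρ) x = 1 / x ^ 2 * rectP lam ρ (1 / x ^ 2) := by
  have h0 := edge_nonneg ρ hN
  have hx0 : 0 < x := h0.trans_lt hx
  have h : ∀ i, ρ i < x ^ 2 := fun i =>
    (le_edge_sq hρ i).trans_lt (pow_lt_pow_left₀ hx h0 two_ne_zero)
  rw [rectCauchy, cauchyTransform_eq_momentFn hρ hx0 h, rectP]
  field_simp

section MomentFn

variable {lam e : ℝ} {ρ : Fin N → ℝ}

lemma one_sub_mul_pos (hρ : ∀ i, 0 ≤ ρ i) (he : ∀ i, ρ i ≤ e ^ 2) {w : ℝ}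
    (hw1 : w * e ^ 2 < 1) (i : Fin N) : 0 < 1 - ρ i * w := by
  rcases le_total w 0 with h | h
  · nlinarith [mul_nonneg (hρ i) (neg_nonneg.2 h)]
  · nlinarith [mul_le_mul_of_nonneg_right (he i) h]

lemma momentFn_zero (hN : 0 < N) : momentFn ρ 0 = 1 := by
  have : (N : ℝ) ≠ 0 := by positivity
  simp [momentFn, this]

lemma momentFn_mono (hρ : ∀ i, 0 ≤ ρ i) (he : ∀ i, ρ i ≤ e ^ 2) {w w' : ℝ} (h : w ≤ w')
    (hw1 : w' * e ^ 2 < 1) : momentFn ρ w ≤ momentFn ρ w' := by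
  refine div_le_div_of_nonneg_right (Finset.sum_le_sum fun i _ => ?_) (by positivity)
  exact inv_anti₀ (one_sub_mul_pos hρ he hw1 i)
    (sub_le_sub_left (mul_le_mul_of_nonneg_left h (hρ i)) _)

lemma one_le_momentFn (hN : 0 < N) (hρ : ∀ i, 0 ≤ ρ i) (he : ∀ i, ρ i ≤ e ^ 2) {w : ℝ}
    (hw : 0 ≤ w) (hw1 : w * e ^ 2 < 1) : 1 ≤ momentFn ρ w :=
  (momentFn_zero hN).symm.le.trans (momentFn_mono hρ he hw hw1)

lemma one_le_rectP (hlam0 : 0 < lam) (hN : 0 < N) (hρ : ∀ i, 0 ≤ ρ i)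
    (he : ∀ i, ρ i ≤ e ^ 2) {w : ℝ} (hw : 0 ≤ w) (hw1 : w * e ^ 2 < 1) : 1 ≤ rectP lam ρ w := by
  have h := one_le_momentFn hN hρ he hw hw1
  rw [rectP]
  -- `P = M + λ M (M - 1)` with `M ≥ 1`.
  nlinarith [mul_nonneg hlam0.le (mul_nonneg (zero_le_one.trans h) (sub_nonneg.2 h))]

lemma strictMonoOn_mul_rectP (hlam0 : 0 < lam) (hlam1 : lam ≤ 1) (hN : 0 < N) (hρ : ∀ i, 0 ≤ ρ i)
    (he : ∀ i, ρ i ≤ e ^ 2) :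
    StrictMonoOn (fun w => w * rectP lam ρ w) {w | 0 ≤ w ∧ w * e ^ 2 < 1} := by
  intro a ha b hb hab
  have h1 := one_le_rectP hlam0 hN hρ he ha.1 ha.2
  have h2 : rectP lam ρ a ≤ rectP lam ρ b := by
    have := momentFn_mono hρ he hab.le hb.2
    have h3 := one_le_momentFn hN hρ he ha.1 ha.2
    rw [rectP, rectP]
    gcongr
  have h3 := ha.1
  show a * _ < b * _
  nlinarith

lemma analyticAt_momentFn (hρ : ∀ i, 0 ≤ ρ i) (he : ∀ i, ρ i ≤ e ^ 2) {w : ℝ}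
    (hw1 : w * e ^ 2 < 1) : AnalyticAt ℝ (momentFn ρ) w := by
  unfold momentFn
  refine AnalyticAt.div_const (Finset.analyticAt_fun_sum _ fun i _ => ?_)
  exact AnalyticAt.inv (by fun_prop) (one_sub_mul_pos hρ he hw1 i).ne'

lemma analyticAt_rectP (hρ : ∀ i, 0 ≤ ρ i) (he : ∀ i, ρ i ≤ e ^ 2) {w : ℝ}
    (hw1 : w * e ^ 2 < 1) : AnalyticAt ℝ (rectP lam ρ) w := by
  have := analyticAt_momentFn hρ he hw1
  unfold rectP
  fun_prop

lemma deriv_mul_rectP_pos (hlam0 : 0 < lam) (hlam1 : lam ≤ 1) (hN : 0 < N) (hρ : ∀ i, 0 ≤ ρ i)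
    (he : ∀ i, ρ i ≤ e ^ 2) {w : ℝ} (hw : 0 ≤ w) (hw1 : w * e ^ 2 < 1) :
    0 < deriv (fun w => w * rectP lam ρ w) w := by
  have hP := one_le_rectP hlam0 hN hρ he hw hw1
  have hM := one_le_momentFn hN hρ he hw hw1
  have hdM : HasDerivAt (momentFn ρ)
      ((∑ i, (-(-(ρ i * 1)) / (1 - ρ i * w) ^ 2)) / N) w := by
    unfold momentFn
    refine HasDerivAt.div_const (HasDerivAt.fun_sum fun i _ => ?_) _
    exact (((hasDerivAt_id w).const_mul (ρ i)).const_sub 1).fun_inv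
      (one_sub_mul_pos hρ he hw1 i).ne'
  set M' := (∑ i, (-(-(ρ i * 1)) / (1 - ρ i * w) ^ 2)) / (N : ℝ) with hM'
  have hM'0 : 0 ≤ M' := by
    refine div_nonneg (Finset.sum_nonneg fun i _ => ?_) (by positivity)
    have := hρ i
    simp only [mul_one, neg_neg]
    positivity
  have hd := (hasDerivAt_id w).mul (((hdM.pow 2).const_mul lam).add (hdM.const_mul (1 - lam)))
  have h2 : deriv (fun w => w * rectP lam ρ w) w = rectP lam ρ w
      + w * (lam * (2 * momentFn ρ w * M') + (1 - lam) * M') := by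
    refine (hd.congr_of_eventuallyEq ?_ |>.deriv).trans ?_
    · exact Eventually.of_forall fun y => by simp [rectP]
    · simp [rectP]
  rw [h2]
  have h1 : 0 ≤ 1 - lam := by linarith
  have h3 : 0 ≤ momentFn ρ w := by linarith
  positivity

lemma exists_mul_rectP_eq (hlam0 : 0 < lam) (hN : 0 < N) (hρ : ∀ i, 0 ≤ ρ i)
    (he : ∀ i, ρ i ≤ e ^ 2) (hmax : ∃ i, ρ i = e ^ 2) {x : ℝ} (hx : 0 ≤ x) :
    ∃ w, 0 ≤ w ∧ w * e ^ 2 < 1 ∧ w * rectP lam ρ w = x := by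
  obtain ⟨b, hb0, hb1, hbx⟩ : ∃ b, 0 ≤ b ∧ b * e ^ 2 < 1 ∧ x ≤ b * rectP lam ρ b := by
    rcases eq_or_ne e 0 with rfl | he0
    · have h1 : x * (0 : ℝ) ^ 2 < 1 := by simp
      exact ⟨x, hx, h1, le_mul_of_one_le_right hx (one_le_rectP hlam0 hN hρ he hx h1)⟩
    · obtain ⟨j, hj⟩ := hmax
      have he2 : 0 < e ^ 2 := by positivity
      have hN0 : (0 : ℝ) < N := by positivity
      -- The atom at the edge alone gives `M(b) ≥ 1/(τN)` for `b = (1-τ)/e²`. This `τ` makes that at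
      -- least `2e²x`, while `τ ≤ 1/2` gives `b ≥ 1/(2e²)`; the product is at least `x`.
      set τ : ℝ := 1 / (2 + N * (2 * e ^ 2 * x)) with hτ
      have hpos : 0 < 2 + N * (2 * e ^ 2 * x) := by positivity
      have hτ0 : 0 < τ := by positivity
      have hτ1 : τ ≤ 1 / 2 := one_div_le_one_div_of_le two_pos (by
        have : 0 ≤ N * (2 * e ^ 2 * x) := by positivity
        linarith)
      have hb1 : (1 - τ) / e ^ 2 * e ^ 2 < 1 := by
        rw [div_mul_cancel₀ _ he2.ne']; linarith
      have hb0 : 0 ≤ (1 - τ) / e ^ 2 := div_nonneg (by linarith) he2.le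
      refine ⟨(1 - τ) / e ^ 2, hb0, hb1, ?_⟩
      set b := (1 - τ) / e ^ 2 with hb
      have hM : 1 / τ / N ≤ momentFn ρ b := by
        refine div_le_div_of_nonneg_right ?_ hN0.le
        refine le_trans (le_of_eq ?_) (Finset.single_le_sum (f := fun i => (1 - ρ i * b)⁻¹)
          (fun i _ => (inv_pos.2 (one_sub_mul_pos hρ he hb1 i)).le) (Finset.mem_univ j))
        simp only [hj, hb, one_div]
        congr 1
        field_simp
        ring
      have hM1 := one_le_momentFn hN hρ he hb0 hb1
      have hPM : momentFn ρ b ≤ rectP lam ρ b := by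
        rw [rectP]; nlinarith [mul_nonneg hlam0.le (mul_nonneg (zero_le_one.trans hM1)
          (sub_nonneg.2 hM1))]
      have h2 : 2 * e ^ 2 * x ≤ rectP lam ρ b := by
        refine le_trans ?_ (hM.trans hPM)
        rw [hτ, one_div_one_div, le_div_iff₀ hN0]
        nlinarith
      have h3 : 1 / (2 * e ^ 2) ≤ b := by
        rw [hb, div_le_div_iff₀ (by positivity) he2]; nlinarith
      calc x = 1 / (2 * e ^ 2) * (2 * e ^ 2 * x) := by field_simp
        _ ≤ b * rectP lam ρ b := mul_le_mul h3 h2 (by positivity) hb0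
  have hsub : ∀ w ∈ Icc 0 b, 0 ≤ w ∧ w * e ^ 2 < 1 := fun w hw =>
    ⟨hw.1, (mul_le_mul_of_nonneg_right hw.2 (sq_nonneg e)).trans_lt hb1⟩
  have hcont : ContinuousOn (fun w => w * rectP lam ρ w) (Icc 0 b) := fun w hw =>
    (continuousAt_id.mul
      (analyticAt_rectP hρ he (hsub w hw).2).continuousAt).continuousWithinAt
  obtain ⟨w, hw, hwx⟩ := intermediate_value_Icc hb0 hcont (show x ∈ Icc _ _ from ⟨by simpa, hbx⟩)
  exact ⟨w, (hsub w hw).1, (hsub w hw).2, hwx⟩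

end MomentFn

/-! ### The compositional inverses -/

section Inverse

variable {lam : ℝ} {ρ : Fin N → ℝ}

lemma rectHInv_spec (hlam0 : 0 < lam) (hN : 0 < N) (hρ : ∀ i, 0 ≤ ρ i) {x : ℝ}
    (hx : 0 ≤ x) :
    0 ≤ rectHInv lam (symmAtomicLaw ρ) x ∧
      rectHInv lam (symmAtomicLaw ρ) x * edge (symmAtomicLaw ρ) ^ 2 < 1 ∧
      rectHInv lam (symmAtomicLaw ρ) x * rectP lam ρ (rectHInv lam (symmAtomicLaw ρ) x) = x := by
  obtain ⟨w, hw0, hw1, hwx⟩ := exists_mul_rectP_eq hlam0 hN hρ (le_edge_sq hρ)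
    (exists_eq_edge_sq hN hρ) hx
  have hex : ∃ w ∈ {w | 0 ≤ w ∧ w * edge (symmAtomicLaw ρ) ^ 2 < 1},
      rectH lam (symmAtomicLaw ρ) w = x := ⟨w, ⟨hw0, hw1⟩, by rw [rectH_eq hρ hw0 hw1, hwx]⟩
  have hm := Function.invFunOn_mem hex
  have he := Function.invFunOn_eq hex
  refine ⟨hm.1, hm.2, ?_⟩
  rwa [rectH_eq hρ hm.1 hm.2] at he

lemma rectHInv_eq_of_mul_rectP_eq (hlam0 : 0 < lam) (hlam1 : lam ≤ 1) (hN : 0 < N)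
    (hρ : ∀ i, 0 ≤ ρ i) {w x : ℝ} (hw : 0 ≤ w) (hw1 : w * edge (symmAtomicLaw ρ) ^ 2 < 1)
    (h : w * rectP lam ρ w = x) : rectHInv lam (symmAtomicLaw ρ) x = w := by
  have hx : 0 ≤ x := h ▸ mul_nonneg hw
    (zero_le_one.trans (one_le_rectP hlam0 hN hρ (le_edge_sq hρ) hw hw1))
  obtain ⟨h0, h1, h2⟩ := rectHInv_spec hlam0 hN hρ hx
  exact (strictMonoOn_mul_rectP hlam0 hlam1 hN hρ (le_edge_sq hρ)).injOn ⟨h0, h1⟩ ⟨hw, hw1⟩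
    (h2.trans h.symm)

lemma rectHInv_pos (hlam0 : 0 < lam) (hN : 0 < N) (hρ : ∀ i, 0 ≤ ρ i) {x : ℝ}
    (hx : 0 < x) : 0 < rectHInv lam (symmAtomicLaw ρ) x := by
  obtain ⟨h0, -, h2⟩ := rectHInv_spec hlam0 hN hρ hx.le
  refine h0.lt_of_ne fun h => ?_
  rw [← h, zero_mul] at h2
  exact hx.ne h2

/-- The transform at infinity evaluated at `z` is the transform at zero evaluated at `1/z²`, so the
two inverses correspond under `w = 1/z²`. -/
lemma rectCauchyInv_spec (hlam0 : 0 < lam) (hlam1 : lam ≤ 1) (hN : 0 < N) (hρ : ∀ i, 0 ≤ ρ i)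
    {x : ℝ} (hx : 0 < x) :
    edge (symmAtomicLaw ρ) < rectCauchyInv lam (symmAtomicLaw ρ) x ∧
      rectHInv lam (symmAtomicLaw ρ) x = 1 / rectCauchyInv lam (symmAtomicLaw ρ) x ^ 2 := by
  obtain ⟨h0, h1, h2⟩ := rectHInv_spec hlam0 hN hρ hx.le
  have hpos := rectHInv_pos hlam0 hN hρ hx
  set w := rectHInv lam (symmAtomicLaw ρ) x
  have he := edge_nonneg ρ hN
  have hz : edge (symmAtomicLaw ρ) < 1 / √w := by
    rw [lt_div_iff₀ (Real.sqrt_pos.2 hpos)]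
    refine lt_of_pow_lt_pow_left₀ 2 zero_le_one ?_
    rw [mul_pow, Real.sq_sqrt h0]
    linarith
  have hzw : 1 / (1 / √w) ^ 2 = w := by rw [div_pow, Real.sq_sqrt h0]; simp
  have hex : ∃ z ∈ Ioi (edge (symmAtomicLaw ρ)), rectCauchy lam (symmAtomicLaw ρ) z = x :=
    ⟨_, hz, by rw [rectCauchy_eq hN hρ hz, hzw, h2]⟩
  have hm : edge (symmAtomicLaw ρ) < rectCauchyInv lam (symmAtomicLaw ρ) x :=
    Function.invFunOn_mem hex
  have heq : rectCauchy lam (symmAtomicLaw ρ) (rectCauchyInv lam (symmAtomicLaw ρ) x) = x :=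
    Function.invFunOn_eq hex
  refine ⟨hm, rectHInv_eq_of_mul_rectP_eq hlam0 hlam1 hN hρ (by positivity) ?_ ?_⟩
  · rw [div_mul_eq_mul_div, one_mul, div_lt_one (by nlinarith)]
    exact pow_lt_pow_left₀ hm he two_ne_zero
  · rwa [rectCauchy_eq hN hρ hm] at heq

lemma rectR_eq (hlam0 : 0 < lam) (hN : 0 < N) (hρ : ∀ i, 0 ≤ ρ i) {x : ℝ}
    (hx : 0 < x) :
    rectR lam (symmAtomicLaw ρ) x =
      rectU lam (rectP lam ρ (rectHInv lam (symmAtomicLaw ρ) x) - 1) := by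
  obtain ⟨-, -, h2⟩ := rectHInv_spec hlam0 hN hρ hx.le
  have hpos := rectHInv_pos hlam0 hN hρ hx
  rw [rectR]
  congr 2
  rw [div_eq_iff hpos.ne', mul_comm]
  exact h2.symm

end Inverse

/-! ### Analyticity of the rectangular `R`-transform -/

lemma exists_analyticAt_rightInverse {f : ℝ → ℝ} {a : ℝ} (hf : AnalyticAt ℝ f a)
    (hd : deriv f a ≠ 0) :
    ∃ k : ℝ → ℝ, AnalyticAt ℝ k (f a) ∧ k (f a) = a ∧ ∀ᶠ y in 𝓝 (f a), f (k y) = y := by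
  -- The exponent `⊤` is the analytic one, so the local inverse is analytic and not only smooth.
  have hc : ContDiffAt ℝ ⊤ f a := hf.contDiffAt
  have hs : HasStrictDerivAt f (deriv f a) a := hf.hasStrictDerivAt
  have hs' := hs.hasStrictFDerivAt_equiv hd
  refine ⟨hc.localInverse hs'.hasFDerivAt (by simp), ?_, hc.localInverse_apply_image _ _,
    hs'.eventually_right_inverse⟩
  exact (hc.to_localInverse hs'.hasFDerivAt (by simp)).analyticAt

lemma analyticAt_rectU {lam : ℝ} (hlam0 : 0 < lam) {u : ℝ} (hu : 0 ≤ u) :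
    AnalyticAt ℝ (rectU lam) u := by
  have h : AnalyticAt ℝ (fun x => √((lam + 1) ^ 2 + 4 * lam * x)) u := by
    have h1 : AnalyticAt ℝ Real.sqrt ((lam + 1) ^ 2 + 4 * lam * u) :=
      (Real.contDiffAt_sqrt (by positivity)).analyticAt
    exact AnalyticAt.fun_comp (f := fun x => (lam + 1) ^ 2 + 4 * lam * x) h1 (by fun_prop)
  unfold rectU
  fun_prop

variable {N : ℕ} {lam : ℝ} {ρ : Fin N → ℝ}

lemma analyticAt_rectU_rectP (hlam0 : 0 < lam) (hN : 0 < N)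
    (hρ : ∀ i, 0 ≤ ρ i) {w : ℝ} (hw : 0 ≤ w) (hw1 : w * edge (symmAtomicLaw ρ) ^ 2 < 1) :
    AnalyticAt ℝ (fun w => rectU lam (rectP lam ρ w - 1)) w := by
  have h1 : AnalyticAt ℝ (fun w => rectP lam ρ w - 1) w :=
    (analyticAt_rectP hρ (le_edge_sq hρ) hw1).sub analyticAt_const
  exact AnalyticAt.fun_comp (analyticAt_rectU hlam0 (sub_nonneg.2
    (one_le_rectP hlam0 hN hρ (le_edge_sq hρ) hw hw1))) h1

/-- Near every point `x₀ ≥ 0` the rectangular `R`-transform agrees, to the right of `0`, with an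
analytic function. -/
lemma exists_analyticAt_eventuallyEq_rectR (hlam0 : 0 < lam) (hlam1 : lam ≤ 1) (hN : 0 < N)
    (hρ : ∀ i, 0 ≤ ρ i) {x₀ : ℝ} (hx₀ : 0 ≤ x₀) :
    ∃ f : ℝ → ℝ, AnalyticAt ℝ f x₀ ∧
      ∀ᶠ x in 𝓝 x₀, 0 < x → rectR lam (symmAtomicLaw ρ) x = f x := by
  obtain ⟨h0, h1, h2⟩ := rectHInv_spec hlam0 hN hρ hx₀
  set w₀ := rectHInv lam (symmAtomicLaw ρ) x₀
  have hP := analyticAt_rectP (lam := lam) hρ (le_edge_sq hρ) h1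
  obtain ⟨k, hk, hk0, hkr⟩ := exists_analyticAt_rightInverse (analyticAt_id.fun_mul hP)
    (deriv_mul_rectP_pos hlam0 hlam1 hN hρ (le_edge_sq hρ) h0 h1).ne'
  have hx : id w₀ * rectP lam ρ w₀ = x₀ := h2
  rw [hx] at hk hk0 hkr
  refine ⟨fun x => rectU lam (rectP lam ρ (k x) - 1), ?_, ?_⟩
  · refine AnalyticAt.fun_comp (g := fun w => rectU lam (rectP lam ρ w - 1)) ?_ hk
    rw [hk0]
    exact analyticAt_rectU_rectP hlam0 hN hρ h0 h1
  · have hkc : Tendsto k (𝓝 x₀) (𝓝 w₀) := hk0 ▸ hk.continuousAt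
    have e1 : ∀ᶠ x in 𝓝 x₀, 0 < rectP lam ρ (k x) :=
      hkc.eventually (hP.continuousAt.eventually (lt_mem_nhds (zero_lt_one.trans_le
        (one_le_rectP hlam0 hN hρ (le_edge_sq hρ) h0 h1))))
    have e2 : ∀ᶠ x in 𝓝 x₀, k x * edge (symmAtomicLaw ρ) ^ 2 < 1 :=
      hkc.eventually ((continuous_id.mul continuous_const).continuousAt.eventually
        (gt_mem_nhds h1))
    filter_upwards [e1, e2, hkr] with x hx1 hx2 hx3 hx4
    have hx5 : k x * rectP lam ρ (k x) = x := hx3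
    -- The local inverse `k` extends to both sides of `0`; positivity of `x` and of `P` places `k x`
    -- in the domain on which `rectHInv` is the inverse.
    have hx6 : 0 < k x := pos_of_mul_pos_left (hx5.symm ▸ hx4) hx1.le
    rw [rectR_eq hlam0 hN hρ hx4,
      rectHInv_eq_of_mul_rectP_eq hlam0 hlam1 hN hρ hx6.le hx2 hx5]

lemma analyticAt_rectR (hlam0 : 0 < lam) (hlam1 : lam ≤ 1) (hN : 0 < N) (hρ : ∀ i, 0 ≤ ρ i)
    {x : ℝ} (hx : 0 < x) : AnalyticAt ℝ (rectR lam (symmAtomicLaw ρ)) x := by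
  obtain ⟨f, hf, h⟩ := exists_analyticAt_eventuallyEq_rectR hlam0 hlam1 hN hρ hx.le
  refine hf.congr ?_
  filter_upwards [h, lt_mem_nhds hx] with y h1 h2 using (h1 h2).symm

/-- A function analytic on the positive half-line which is the sum of a power series near `0` is the
sum of that series at every positive point of absolute convergence. -/
lemma hasSum_of_summable_of_analyticOnNhd {f : ℝ → ℝ} {a : ℕ → ℝ}
    (hf : AnalyticOnNhd ℝ f (Ioi 0))
    (ha : ∀ᶠ x in 𝓝[>] (0 : ℝ), HasSum (fun k => a k * x ^ k) (f x)) {x : ℝ} (hx : 0 < x)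
    (hs : Summable fun k => |a k * x ^ k|) : HasSum (fun k => a k * x ^ k) (f x) := by
  set p := FormalMultilinearSeries.ofScalars ℝ a with hp
  have hpn : ∀ n, ‖p n‖ = |a n| := fun n => by
    simp [hp]
  have hrad : ENNReal.ofReal x ≤ p.radius := by
    refine p.le_radius_of_summable ?_
    refine hs.congr fun n => ?_
    rw [hpn, abs_mul, abs_pow, abs_of_pos hx, Real.coe_toNNReal _ hx.le]
  have hsum : ∀ y, p.sum y = ∑' n, a n * y ^ n := fun y => by
    simp [hp, FormalMultilinearSeries.sum, mul_comm]
  have hpos : 0 < p.radius := (ENNReal.ofReal_pos.2 hx).trans_le hrad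
  have hA : AnalyticOnNhd ℝ p.sum (Ioo 0 x) := fun y hy => by
    refine (p.hasFPowerSeriesOnBall hpos).analyticAt_of_mem ?_
    refine Metric.eball_subset_eball hrad ?_
    rw [Metric.mem_eball, edist_dist, Real.dist_eq, sub_zero, abs_of_pos hy.1]
    exact (ENNReal.ofReal_lt_ofReal_iff hx).2 hy.2
  obtain ⟨δ, hδ, hδs⟩ := mem_nhdsGT_iff_exists_Ioo_subset.1 ha
  have hδ : 0 < δ := hδ
  have hEq : EqOn p.sum f (Ioo 0 x) := by
    refine hA.eqOn_of_preconnected_of_eventuallyEq (hf.mono fun y hy => hy.1)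
      isPreconnected_Ioo (z₀ := min δ x / 2) ⟨by positivity, ?_⟩ ?_
    · linarith [min_le_right δ x]
    · filter_upwards [Ioo_mem_nhds (show 0 < min δ x / 2 by positivity)
        (show min δ x / 2 < δ by linarith [min_le_left δ x])] with y hy
      rw [hsum]
      exact (hδs hy).tsum_eq
  -- The point `x` may lie on the boundary of the disc of convergence. Domination by the summable
  -- terms at `x` gives continuity up to `x`, so the identity on `(0, x)` passes to the endpoint.
  have hcont : ContinuousOn (fun y => ∑' n, a n * y ^ n) (Icc 0 x) := by
    refine continuousOn_tsum (fun n => by fun_prop) hs fun n y hy => ?_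
    rw [Real.norm_eq_abs, abs_mul, abs_mul, abs_pow, abs_pow, abs_of_nonneg hy.1, abs_of_pos hx]
    gcongr
    exacts [hy.1, hy.2]
  have l1 : Tendsto (fun y => ∑' n, a n * y ^ n) (𝓝[<] x) (𝓝 (∑' n, a n * x ^ n)) := by
    refine (hcont x ⟨hx.le, le_rfl⟩).tendsto.mono_left ?_
    rw [← nhdsWithin_Ioo_eq_nhdsLT hx]
    exact nhdsWithin_mono _ Ioo_subset_Icc_self
  have l2 : Tendsto (fun y => ∑' n, a n * y ^ n) (𝓝[<] x) (𝓝 (f x)) := by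
    refine ((hf x hx).continuousAt.tendsto.mono_left nhdsWithin_le_nhds).congr' ?_
    filter_upwards [Ioo_mem_nhdsLT hx] with y hy
    rw [← hEq hy, hsum]
  rw [← tendsto_nhds_unique l1 l2]
  exact hs.of_abs.hasSum

lemma exists_hasSum_rectR (hlam0 : 0 < lam) (hlam1 : lam ≤ 1) (hN : 0 < N) (hρ : ∀ i, 0 ≤ ρ i) :
    ∃ a : ℕ → ℝ, ∀ᶠ x in 𝓝[>] (0 : ℝ),
      HasSum (fun k => a k * x ^ k) (rectR lam (symmAtomicLaw ρ) x) := by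
  obtain ⟨f, ⟨p, hp⟩, h⟩ := exists_analyticAt_eventuallyEq_rectR hlam0 hlam1 hN hρ le_rfl
  refine ⟨p.coeff, ?_⟩
  filter_upwards [nhdsWithin_le_nhds (hasFPowerSeriesAt_iff'.1 hp), nhdsWithin_le_nhds h,
    self_mem_nhdsWithin] with x h1 h2 h3
  rw [h2 h3]
  simpa [mul_comm] using h1

/-! ### Laplace's method and differentiation of Laplace transforms -/

section Laplace

variable {Ω : Type*} [MeasurableSpace Ω] {ν : Measure Ω}

/-- Laplace's method for an observable `g`: the exponential weights `e^{-qΨ}` concentrate where `Ψ`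
vanishes, hence where `g` is close to `g₀`. -/
lemma tendsto_integral_mul_exp_div_integral_exp {Ψ g : Ω → ℝ} {g₀ : ℝ}
    (hint : ∀ q, 0 < q → Integrable (fun v => Real.exp (-q * Ψ v)) ν)
    (hintg : ∀ q, 0 < q → Integrable (fun v => g v * Real.exp (-q * Ψ v)) ν)
    (hgap : ∀ ε, 0 < ε → ∃ m, 0 < m ∧ ∀ᵐ v ∂ν, ε ≤ |g v - g₀| → m ≤ Ψ v)
    (hpos : ∀ η, 0 < η → ν {v | Ψ v ≤ η} ≠ 0)
    {q : ℕ → ℝ} (hq : Tendsto q atTop atTop) :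
    Tendsto (fun n => (∫ v, g v * Real.exp (-q n * Ψ v) ∂ν) / ∫ v, Real.exp (-q n * Ψ v) ∂ν)
      atTop (𝓝 g₀) := by
  have hintd : ∀ q, 0 < q → Integrable (fun v => (g v - g₀) * Real.exp (-q * Ψ v)) ν :=
    fun q hq => by
      simp only [sub_mul]
      exact (hintg q hq).sub ((hint q hq).const_mul g₀)
  have hinta : ∀ q, 0 < q → Integrable (fun v => |g v - g₀| * Real.exp (-q * Ψ v)) ν :=
    fun q hq => (hintd q hq).abs.congr (Eventually.of_forall fun v => by
      simp [abs_mul])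
  rw [Metric.tendsto_atTop']
  intro ε hε
  obtain ⟨m, hm, hgm⟩ := hgap (ε / 2) (half_pos hε)
  -- On this sublevel set the weight is at least `e^{-qm/2}`, whereas away from `g₀` it is of order
  -- `e^{-qm}`; the ratio decays like `e^{-qm/2}`.
  set S := {v | Ψ v ≤ m / 2} with hS
  have hSlt : ν S < ⊤ := by
    refine lt_of_le_of_lt (measure_mono fun v hv => ?_)
      ((hint 1 one_pos).measure_ge_lt_top (Real.exp_pos (-(m / 2))))
    have : Ψ v ≤ m / 2 := hv
    exact Real.exp_le_exp.2 (by linarith)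
  have hV : 0 < ν.real S := ENNReal.toReal_pos (hpos _ (half_pos hm)) hSlt.ne
  set C := ∫ v, |g v - g₀| * Real.exp (-1 * Ψ v) ∂ν with hC
  have hlow : ∀ q, 0 < q → Real.exp (-q * (m / 2)) * ν.real S ≤ ∫ v, Real.exp (-q * Ψ v) ∂ν := by
    intro q hq
    have := mul_meas_ge_le_integral_of_nonneg
      (Eventually.of_forall fun v => (Real.exp_pos (-q * Ψ v)).le) (hint q hq)
      (Real.exp (-q * (m / 2)))
    refine le_trans (le_of_eq ?_) this
    congr 2
    ext v
    simp only [hS, mem_ofPred_eq, Real.exp_le_exp]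
    constructor <;> intro h <;> nlinarith
  -- Where `g` is far from `g₀`, `Ψ ≥ m` is spent on `q - 1` of the `q` copies of `Ψ`; the remaining
  -- copy keeps the integral finite and independent of `q`.
  have hup : ∀ q, 1 < q → ∫ v, |g v - g₀| * Real.exp (-q * Ψ v) ∂ν ≤
      ε / 2 * (∫ v, Real.exp (-q * Ψ v) ∂ν) + Real.exp (-(q - 1) * m) * C := by
    intro q hq
    have hq0 : 0 < q := by linarith
    rw [hC, ← integral_const_mul, ← integral_const_mul,
      ← integral_add ((hint q hq0).const_mul _) ((hinta 1 one_pos).const_mul _)]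
    refine integral_mono_ae (hinta q hq0)
      (((hint q hq0).const_mul _).add ((hinta 1 one_pos).const_mul _)) ?_
    filter_upwards [hgm] with v hv
    rcases le_or_gt (ε / 2) |g v - g₀| with h | h
    · have h1 : Real.exp (-q * Ψ v) ≤ Real.exp (-(q - 1) * m) * Real.exp (-1 * Ψ v) := by
        rw [← Real.exp_add, Real.exp_le_exp]
        nlinarith [hv h]
      have h2 : 0 ≤ ε / 2 * Real.exp (-q * Ψ v) := by positivity
      have h3 := mul_le_mul_of_nonneg_left h1 (abs_nonneg (g v - g₀))
      linarith
    · have h1 := mul_le_mul_of_nonneg_right h.le (Real.exp_pos (-q * Ψ v)).le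
      have h2 : 0 ≤ Real.exp (-(q - 1) * m) * (|g v - g₀| * Real.exp (-1 * Ψ v)) := by positivity
      linarith
  have hlim : Tendsto (fun q : ℝ => Real.exp m * C / ν.real S * Real.exp (-(q * (m / 2)))) atTop
      (𝓝 0) := by
    have := (Real.tendsto_exp_neg_atTop_nhds_zero.comp
      (tendsto_id.atTop_mul_const (half_pos hm))).const_mul (Real.exp m * C / ν.real S)
    simpa using this
  have hev := (hlim.comp hq).eventually (gt_mem_nhds (half_pos hε))
  obtain ⟨n₀, hn₀⟩ := eventually_atTop.1 (hev.and (hq.eventually_gt_atTop 1))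
  refine ⟨n₀, fun n hn => ?_⟩
  obtain ⟨h1, h2⟩ := hn₀ n hn.le
  rw [Function.comp_apply] at h1
  generalize q n = q at h1 h2
  have hq0 : 0 < q := by linarith
  have hl := hlow q hq0
  set I := ∫ v, Real.exp (-q * Ψ v) ∂ν with hI
  have hI0 : 0 < I := lt_of_lt_of_le (by positivity) hl
  have e1 : (∫ v, g v * Real.exp (-q * Ψ v) ∂ν) / I - g₀
      = (∫ v, (g v - g₀) * Real.exp (-q * Ψ v) ∂ν) / I := by
    simp only [sub_mul]
    rw [integral_sub (hintg q hq0) ((hint q hq0).const_mul g₀), integral_const_mul, ← hI]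
    field_simp
  have e2 : |∫ v, (g v - g₀) * Real.exp (-q * Ψ v) ∂ν|
      ≤ ∫ v, |g v - g₀| * Real.exp (-q * Ψ v) ∂ν := by
    refine (abs_integral_le_integral_abs).trans (le_of_eq ?_)
    simp [abs_mul]
  have hC0 : 0 ≤ C := integral_nonneg fun v => by positivity
  have e3 : Real.exp (-(q - 1) * m) * C ≤
      Real.exp m * C / ν.real S * Real.exp (-(q * (m / 2))) * I := by
    calc Real.exp (-(q - 1) * m) * C
        = Real.exp m * C / ν.real S * Real.exp (-(q * (m / 2))) *
          (Real.exp (-q * (m / 2)) * ν.real S) := by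
          have : Real.exp (-(q - 1) * m) =
              Real.exp m * Real.exp (-(q * (m / 2))) * Real.exp (-q * (m / 2)) := by
            rw [← Real.exp_add, ← Real.exp_add]; ring_nf
          rw [this]
          field_simp
      _ ≤ _ := by gcongr
  have e4 : Real.exp m * C / ν.real S * Real.exp (-(q * (m / 2))) * I < ε / 2 * I :=
    mul_lt_mul_of_pos_right h1 hI0
  rw [Real.dist_eq, e1, abs_div, abs_of_pos hI0, div_lt_iff₀ hI0]
  linarith [hup q h2]

/-- Half of the rate `r` absorbs the factor `g`, because `a g ≤ e^{a g}` with `a = q r/2`. -/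
lemma integrable_mul_exp_of_forall_integrable {g φ : Ω → ℝ} (hg : AEStronglyMeasurable g ν)
    (hg0 : ∀ᵐ v ∂ν, 0 ≤ g v) {q : ℝ} (hq : 0 < q)
    (hint : ∀ r, 0 < r → Integrable (fun v => Real.exp (-q * (g v * r + φ v))) ν)
    {r : ℝ} (hr : 0 < r) : Integrable (fun v => g v * Real.exp (-q * (g v * r + φ v))) ν := by
  refine ((hint (r / 2) (half_pos hr)).const_mul (1 / (q * (r / 2)))).mono'
    (hg.mul (hint r hr).1) ?_
  filter_upwards [hg0] with v hv
  rw [Real.norm_eq_abs, abs_mul, abs_of_nonneg hv, Real.abs_exp]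
  have h1 : Real.exp (-q * (g v * (r / 2) + φ v)) =
      Real.exp (q * (r / 2) * g v) * Real.exp (-q * (g v * r + φ v)) := by
    rw [← Real.exp_add]; ring_nf
  rw [h1, ← mul_assoc]
  refine mul_le_mul_of_nonneg_right ?_ (Real.exp_pos _).le
  rw [div_mul_eq_mul_div, one_mul, le_div_iff₀ (by positivity)]
  linarith [Real.add_one_le_exp (q * (r / 2) * g v)]

lemma hasDerivAt_log_integral_exp [NeZero ν] {g φ : Ω → ℝ} (hg : AEStronglyMeasurable g ν)
    (hg0 : ∀ᵐ v ∂ν, 0 ≤ g v) {q : ℝ} (hq : 0 < q)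
    (hint : ∀ r, 0 < r → Integrable (fun v => Real.exp (-q * (g v * r + φ v))) ν)
    {r : ℝ} (hr : 0 < r) :
    HasDerivAt (fun r => 1 / q * Real.log (∫ v, Real.exp (-q * (g v * r + φ v)) ∂ν))
      (-((∫ v, g v * Real.exp (-q * (g v * r + φ v)) ∂ν) /
        ∫ v, Real.exp (-q * (g v * r + φ v)) ∂ν)) r := by
  have key : HasDerivAt (fun r => ∫ v, Real.exp (-q * (g v * r + φ v)) ∂ν)
      (∫ v, -q * (g v * Real.exp (-q * (g v * r + φ v))) ∂ν) r := by
    refine (hasDerivAt_integral_of_dominated_loc_of_deriv_le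
      (F' := fun r v => -q * (g v * Real.exp (-q * (g v * r + φ v))))
      (bound := fun v => q * (g v * Real.exp (-q * (g v * (r / 2) + φ v))))
      (Ioi_mem_nhds (half_lt_self hr)) ?_ (hint r hr) ?_ ?_ ?_ ?_).2
    · filter_upwards [Ioi_mem_nhds hr] with x hx using (hint x hx).1
    · exact ((integrable_mul_exp_of_forall_integrable hg hg0 hq hint hr).const_mul _).1
    · filter_upwards [hg0] with v hv x hx
      have hx : r / 2 < x := hx
      rw [norm_mul, norm_mul, Real.norm_eq_abs, Real.norm_eq_abs, Real.norm_eq_abs, abs_neg,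
        abs_of_pos hq, abs_of_nonneg hv, Real.abs_exp]
      gcongr _ * (_ * Real.exp ?_)
      nlinarith [mul_le_mul_of_nonneg_left hx.le hv]
    · exact (integrable_mul_exp_of_forall_integrable hg hg0 hq hint (half_pos hr)).const_mul _
    · refine Eventually.of_forall fun v x _ => ?_
      have h := ((((hasDerivAt_id x).const_mul (g v)).add_const (φ v)).const_mul (-q)).exp
      refine h.congr_deriv ?_
      simp only [id]
      ring
  have hI : 0 < ∫ v, Real.exp (-q * (g v * r + φ v)) ∂ν := integral_exp_pos (hint r hr)
  refine ((key.log hI.ne').const_mul (1 / q)).congr_deriv ?_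
  rw [integral_const_mul]
  have : ∀ I J : ℝ, 1 / q * (-q * J / I) = -(J / I) := fun I J => by field_simp
  exact this _ _

end Laplace

/-! ### The Fuglede–Kadison potential of a symmetric atomic law -/

section Potential

variable {N : ℕ} {lam : ℝ} {ρ : Fin N → ℝ}

/-- The logarithm of the rectangular Fuglede–Kadison determinant, in terms of the squared
singular values. -/
def fkExp (lam : ℝ) (ρ : Fin N → ℝ) (x y : ℝ) : ℝ :=
  (1 - lam) / √lam * Real.log y + √lam * ((∑ i, Real.log (x * y - ρ i)) / N)

lemma mul_sub_pos_of_edge_lt (hN : 0 < N) (hρ : ∀ i, 0 ≤ ρ i) {x y : ℝ}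
    (hx : edge (symmAtomicLaw ρ) < x) (hy : edge (symmAtomicLaw ρ) < y) (i : Fin N) :
    0 < x * y - ρ i := by
  have h0 := edge_nonneg ρ hN
  nlinarith [le_edge_sq hρ i]

lemma det_smul_one_sub_transpose_mul_self {m d : ℕ} (A : Matrix (Fin m) (Fin d) ℝ) (T : ℝ) :
    (T • (1 : Matrix (Fin d) (Fin d) ℝ) - Aᵀ * A).det =
      ∏ i, (T - (Matrix.isHermitian_conjTranspose_mul_self A).eigenvalues i) := by
  have h := congrArg (Polynomial.eval T) (Matrix.isHermitian_conjTranspose_mul_self A).charpoly_eq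
  rw [Matrix.eval_charpoly, Polynomial.eval_prod] at h
  simpa [Matrix.smul_one_eq_diagonal] using h

/-- The size `d` of `A` varies while `ρ` stays fixed. Integrating `log(xy - u²)` against the common
law identifies the normalized log-determinants. -/
lemma rectFK_eq {m d : ℕ} {A : Matrix (Fin m) (Fin d) ℝ} (hd : 0 < d) (hN : 0 < N)
    (hρ : ∀ i, 0 ≤ ρ i) (hA : symmSingularLaw A = symmAtomicLaw ρ) {x y : ℝ}
    (hx : edge (symmAtomicLaw ρ) < x) (hy : edge (symmAtomicLaw ρ) < y) :
    rectFK lam A x y = Real.exp (fkExp lam ρ x y) := by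
  set σ := (Matrix.isHermitian_conjTranspose_mul_self A).eigenvalues with hσ
  have hσ0 : ∀ i, 0 ≤ σ i := (Matrix.posSemidef_conjTranspose_mul_self A).eigenvalues_nonneg
  have hA' : symmAtomicLaw σ = symmAtomicLaw ρ := hA
  have hpos : ∀ i, 0 < x * y - σ i :=
    mul_sub_pos_of_edge_lt hd hσ0 (by rwa [hA']) (by rwa [hA'])
  have hlog : (∑ i, Real.log (x * y - σ i)) / d = (∑ i, Real.log (x * y - ρ i)) / N := by
    have h := congrArg (fun μ => ∫ u, Real.log (x * y - u ^ 2) ∂μ) hA'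
    simp only [integral_symmAtomicLaw, neg_sq, Real.sq_sqrt (hσ0 _), Real.sq_sqrt (hρ _),
      ← two_mul, ← Finset.mul_sum] at h
    rwa [mul_div_mul_left _ _ two_ne_zero, mul_div_mul_left _ _ two_ne_zero] at h
  have hy0 : 0 < y := (edge_nonneg ρ hN).trans_lt hy
  have hprod : 0 < ∏ i, (x * y - σ i) := Finset.prod_pos fun i _ => hpos i
  rw [rectFK, fkDet, det_smul_one_sub_transpose_mul_self, ← hσ, fkExp, ← hlog, Real.exp_add,
    Real.rpow_def_of_pos hy0, Real.rpow_def_of_pos hprod, ← Real.exp_mul,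
    Real.log_prod fun i _ => (hpos i).ne']
  congr 2 <;> ring

lemma hasDerivAt_fkExp_left (x : ℝ) {y : ℝ} (h : ∀ i, x * y - ρ i ≠ 0) :
    HasDerivAt (fun x => fkExp lam ρ x y) (√lam * ((∑ i, y / (x * y - ρ i)) / N)) x := by
  refine (((HasDerivAt.fun_sum fun i _ => ?_).div_const _).const_mul _).const_add _
  have := (((hasDerivAt_id x).mul_const y).sub_const (ρ i)).log (h i)
  simpa using this

lemma hasDerivAt_fkExp_right (x : ℝ) {y : ℝ} (hy : y ≠ 0) (h : ∀ i, x * y - ρ i ≠ 0) :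
    HasDerivAt (fun y => fkExp lam ρ x y)
      ((1 - lam) / √lam * y⁻¹ + √lam * ((∑ i, x / (x * y - ρ i)) / N)) y := by
  refine ((Real.hasDerivAt_log hy).const_mul _).add
    (((HasDerivAt.fun_sum fun i _ => ?_).div_const _).const_mul _)
  have := (((hasDerivAt_id y).const_mul x).sub_const (ρ i)).log (h i)
  simpa using this

lemma continuousAt_fkExp {x y : ℝ} (hy : y ≠ 0) (h : ∀ i, x * y - ρ i ≠ 0) :
    ContinuousAt (fun v : ℝ × ℝ => fkExp lam ρ v.1 v.2) (x, y) := by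
  unfold fkExp
  refine (continuousAt_const.mul (continuousAt_snd.log hy)).add
    (continuousAt_const.mul (ContinuousAt.div_const (tendsto_finsetSum _ fun i _ => ?_) _))
  exact ContinuousAt.log (by fun_prop) (h i)

lemma measurable_fkExp : Measurable (fun v : ℝ × ℝ => fkExp lam ρ v.1 v.2) := by
  unfold fkExp
  fun_prop

/-- Strict concavity of `log (x y - ρ)` at the point `(z, z)`, with an explicit gap. -/
lemma sub_one_sub_log_le {ρ x y z : ℝ} (hρ : 0 ≤ ρ) (hx : 0 < x) (hz : 0 < z)
    (hxy : 0 < x * y - ρ) (hzz : 0 < z * z - ρ) :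
    x / z - 1 - Real.log (x / z) ≤
      (x + y - 2 * z) * (z / (z * z - ρ)) - (Real.log (x * y - ρ) - Real.log (z * z - ρ)) := by
  have hu : 0 < (x * y - ρ) / x * (z / (z * z - ρ)) := by positivity
  have h1 : Real.log (x * y - ρ) - Real.log (z * z - ρ) =
      Real.log (x / z) + Real.log ((x * y - ρ) / x * (z / (z * z - ρ))) := by
    rw [← Real.log_div hxy.ne' hzz.ne', ← Real.log_mul (by positivity) hu.ne']
    congr 1
    field_simp
  have h2 := Real.log_le_sub_one_of_pos hu
  have h3 : (x + y - 2 * z) * (z / (z * z - ρ)) - (x / z - 1)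
      - ((x * y - ρ) / x * (z / (z * z - ρ)) - 1) = ρ * (z - x) ^ 2 / (x * z * (z * z - ρ)) := by
    have hD := hzz.ne'
    generalize hg : z * z - ρ = D at hD
    obtain rfl : ρ = z * z - D := by linarith
    field_simp
    ring
  have h4 : 0 ≤ ρ * (z - x) ^ 2 / (x * z * (z * z - ρ)) := by positivity
  linarith

/-- The gap at `(z, z)` between the potential and its tangent plane. -/
def fkGap (lam : ℝ) (ρ : Fin N → ℝ) (z x y : ℝ) : ℝ :=
  (x - z) * (√lam * ((∑ i, z / (z * z - ρ i)) / N)) +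
    (y - z) * ((1 - lam) / √lam * z⁻¹ + √lam * ((∑ i, z / (z * z - ρ i)) / N)) -
    (fkExp lam ρ x y - fkExp lam ρ z z)

lemma fkGap_eq (hN : 0 < N) {z x y : ℝ} (hz : 0 < z) (hy : 0 < y) :
    fkGap lam ρ z x y = (1 - lam) / √lam * (y / z - 1 - Real.log (y / z)) +
      √lam * ((∑ i, ((x + y - 2 * z) * (z / (z * z - ρ i)) -
        (Real.log (x * y - ρ i) - Real.log (z * z - ρ i)))) / N) := by
  have : (N : ℝ) ≠ 0 := by positivity
  rw [fkGap, fkExp, fkExp, Real.log_div hy.ne' hz.ne', Finset.sum_sub_distrib,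
    Finset.sum_sub_distrib, ← Finset.mul_sum]
  field_simp
  ring

lemma sub_one_sub_log_nonneg {τ : ℝ} (h : 0 < τ) : 0 ≤ τ - 1 - Real.log τ := by
  linarith [Real.log_le_sub_one_of_pos h]

lemma le_fkGap (hlam1 : lam ≤ 1) (hN : 0 < N) {z x y c : ℝ}
    (hz : 0 < z) (hy : 0 < y)
    (h : ∀ i, c ≤ (x + y - 2 * z) * (z / (z * z - ρ i)) -
        (Real.log (x * y - ρ i) - Real.log (z * z - ρ i))) :
    √lam * c ≤ fkGap lam ρ z x y := by
  have hN0 : (0 : ℝ) < N := by positivity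
  rw [fkGap_eq hN hz hy]
  have h1 : 0 ≤ (1 - lam) / √lam * (y / z - 1 - Real.log (y / z)) :=
    mul_nonneg (div_nonneg (by linarith) (Real.sqrt_nonneg _))
      (sub_one_sub_log_nonneg (by positivity))
  have h2 : c ≤ (∑ i, ((x + y - 2 * z) * (z / (z * z - ρ i)) -
        (Real.log (x * y - ρ i) - Real.log (z * z - ρ i)))) / N := by
    rw [le_div_iff₀ hN0, mul_comm]
    have := Finset.card_nsmul_le_sum (Finset.univ : Finset (Fin N)) _ c fun i _ => h i
    simpa using this
  have h3 := mul_le_mul_of_nonneg_left h2 (Real.sqrt_nonneg lam)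
  linarith

/-- From `log √τ ≤ √τ - 1` one gets `(√τ - 1)² ≤ τ - 1 - log τ`. If `|√τ - 1| < κ ≤ 1` then `√τ + 1
< 3`, so `|τ - 1| < 3κ ≤ ε`. -/
lemma exists_le_sub_one_sub_log {ε : ℝ} (hε : 0 < ε) :
    ∃ m, 0 < m ∧ ∀ τ, 0 < τ → ε ≤ |τ - 1| → m ≤ τ - 1 - Real.log τ := by
  set κ := min 1 (ε / 3) with hκ
  have hκ0 : 0 < κ := by positivity
  have hκ1 : κ ≤ 1 := min_le_left _ _
  have hκ2 : κ ≤ ε / 3 := min_le_right _ _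
  refine ⟨κ ^ 2, by positivity, fun τ hτ h => ?_⟩
  have hs : 0 < √τ := Real.sqrt_pos.2 hτ
  have hsq : √τ ^ 2 = τ := Real.sq_sqrt hτ.le
  have h1 : (√τ - 1) ^ 2 ≤ τ - 1 - Real.log τ := by
    have h2 := Real.log_le_sub_one_of_pos hs
    have h3 : Real.log τ = 2 * Real.log (√τ) := by rw [Real.log_sqrt hτ.le]; ring
    nlinarith
  refine le_trans ?_ h1
  rw [sq_le_sq, abs_of_pos hκ0]
  by_contra! h4
  have h5 := abs_lt.1 h4
  have h6 : |τ - 1| = |√τ - 1| * (√τ + 1) := by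
    rw [show τ - 1 = (√τ - 1) * (√τ + 1) by linear_combination -hsq, abs_mul,
      abs_of_pos (show 0 < √τ + 1 by linarith)]
  have h7 : |√τ - 1| * (√τ + 1) < κ * 3 :=
    mul_lt_mul'' h4 (by linarith) (abs_nonneg _) (by linarith)
  linarith

end Potential

/-! ### Convergence of the finite transform -/

section Convergence

variable {N : ℕ} {lam : ℝ} {ρ : Fin N → ℝ}

lemma le_fkGap_left (hlam1 : lam ≤ 1) (hN : 0 < N) (hρ : ∀ i, 0 ≤ ρ i) {x y z : ℝ}
    (hx : edge (symmAtomicLaw ρ) < x) (hy : edge (symmAtomicLaw ρ) < y)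
    (hz : edge (symmAtomicLaw ρ) < z) :
    √lam * (x / z - 1 - Real.log (x / z)) ≤ fkGap lam ρ z x y := by
  have h0 := edge_nonneg ρ hN
  refine le_fkGap hlam1 hN (h0.trans_lt hz) (h0.trans_lt hy) fun i => ?_
  exact sub_one_sub_log_le (hρ i) (h0.trans_lt hx) (h0.trans_lt hz)
    (mul_sub_pos_of_edge_lt hN hρ hx hy i) (mul_sub_pos_of_edge_lt hN hρ hz hz i)

lemma le_fkGap_right (hlam1 : lam ≤ 1) (hN : 0 < N) (hρ : ∀ i, 0 ≤ ρ i) {x y z : ℝ}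
    (hx : edge (symmAtomicLaw ρ) < x) (hy : edge (symmAtomicLaw ρ) < y)
    (hz : edge (symmAtomicLaw ρ) < z) :
    √lam * (y / z - 1 - Real.log (y / z)) ≤ fkGap lam ρ z x y := by
  have h0 := edge_nonneg ρ hN
  refine le_fkGap hlam1 hN (h0.trans_lt hz) (h0.trans_lt hy) fun i => ?_
  rw [add_comm x y, mul_comm x y]
  exact sub_one_sub_log_le (hρ i) (h0.trans_lt hy) (h0.trans_lt hz)
    (mul_sub_pos_of_edge_lt hN hρ hy hx i) (mul_sub_pos_of_edge_lt hN hρ hz hz i)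

lemma exists_mul_log_le {b κ : ℝ} (hb : 0 ≤ b) (hκ : 0 < κ) :
    ∃ C, ∀ x, 0 < x → b * Real.log x ≤ κ * x + C := by
  -- The constant comes from `log u ≤ u` at `u = κx/(b+1)`; the shift `b + 1` covers `b = 0`.
  refine ⟨-(b * Real.log (κ / (b + 1))), fun x hx => ?_⟩
  have h := Real.log_le_self (show 0 ≤ κ / (b + 1) * x by positivity)
  rw [Real.log_mul (by positivity) hx.ne'] at h
  have h1 := mul_le_mul_of_nonneg_left h hb
  have h2 : b * (κ / (b + 1) * x) ≤ κ * x := by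
    have : b * (κ / (b + 1)) ≤ κ := by
      rw [mul_div_assoc', div_le_iff₀ (by positivity)]
      nlinarith
    nlinarith
  linarith

lemma fkExp_le (hN : 0 < N) (hρ : ∀ i, 0 ≤ ρ i) {x y : ℝ}
    (hx : edge (symmAtomicLaw ρ) < x) (hy : edge (symmAtomicLaw ρ) < y) :
    fkExp lam ρ x y ≤ √lam * Real.log x + ((1 - lam) / √lam + √lam) * Real.log y := by
  have h0 := edge_nonneg ρ hN
  have hN0 : (0 : ℝ) < N := by positivity
  have h1 : (∑ i, Real.log (x * y - ρ i)) / N ≤ Real.log x + Real.log y := by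
    rw [div_le_iff₀ hN0, mul_comm (_ + _)]
    have := Finset.sum_le_card_nsmul (Finset.univ : Finset (Fin N))
      (fun i => Real.log (x * y - ρ i)) (Real.log x + Real.log y) fun i _ => by
        rw [← Real.log_mul (h0.trans_lt hx).ne' (h0.trans_lt hy).ne']
        exact Real.log_le_log (mul_sub_pos_of_edge_lt hN hρ hx hy i) (by linarith [hρ i])
    simpa [mul_add] using this
  have h2 := mul_le_mul_of_nonneg_left h1 (Real.sqrt_nonneg lam)
  rw [fkExp]
  linarith

/-- `fkExp` grows logarithmically, so half of each linear rate absorbs it and an integrable product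
of exponentials remains. -/
lemma integrableOn_exp_fkExp (hlam1 : lam ≤ 1) (hN : 0 < N) (hρ : ∀ i, 0 ≤ ρ i) {q r t : ℝ}
    (hq : 0 < q) (hr : 0 < r) (ht : 0 < t) :
    IntegrableOn (fun v : ℝ × ℝ => Real.exp (-q * (v.1 * r + v.2 * t - fkExp lam ρ v.1 v.2)))
      (Ioi (edge (symmAtomicLaw ρ)) ×ˢ Ioi (edge (symmAtomicLaw ρ))) := by
  obtain ⟨C₁, hC₁⟩ := exists_mul_log_le (Real.sqrt_nonneg lam) (half_pos hr)
  obtain ⟨C₂, hC₂⟩ := exists_mul_log_le (b := (1 - lam) / √lam + √lam)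
    (add_nonneg (div_nonneg (by linarith) (Real.sqrt_nonneg _)) (Real.sqrt_nonneg _)) (half_pos ht)
  have h0 := edge_nonneg ρ hN
  set e := edge (symmAtomicLaw ρ)
  have hdom : Integrable (fun v : ℝ × ℝ => Real.exp (q * (C₁ + C₂)) *
      (Real.exp (-(q * (r / 2)) * v.1) * Real.exp (-(q * (t / 2)) * v.2)))
      (volume.restrict (Ioi e ×ˢ Ioi e)) := by
    rw [Measure.volume_eq_prod, ← Measure.prod_restrict]
    exact (Integrable.mul_prod
      (integrableOn_exp_mul_Ioi (a := -(q * (r / 2))) (neg_neg_of_pos (by positivity)) e)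
      (integrableOn_exp_mul_Ioi (a := -(q * (t / 2))) (neg_neg_of_pos (by positivity)) e)).const_mul _
  refine hdom.mono' ?_ ?_
  · have := measurable_fkExp (lam := lam) (ρ := ρ)
    exact Measurable.aestronglyMeasurable (by fun_prop)
  · filter_upwards [ae_restrict_mem (measurableSet_Ioi.prod measurableSet_Ioi)] with v hv
    have hv1 : e < v.1 := hv.1
    have hv2 : e < v.2 := hv.2
    rw [Real.norm_eq_abs, Real.abs_exp, ← Real.exp_add, ← Real.exp_add, Real.exp_le_exp]
    have h1 := fkExp_le (lam := lam) hN hρ hv1 hv2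
    nlinarith [hC₁ v.1 (h0.trans_lt hv1), hC₂ v.2 (h0.trans_lt hv2)]

lemma logNorm_eq {m d : ℕ} {A : Matrix (Fin m) (Fin d) ℝ} (hm : 0 < m) (hd : 0 < d) (hN : 0 < N)
    (hρ : ∀ i, 0 ≤ ρ i) (hA : symmSingularLaw A = symmAtomicLaw ρ) (r t : ℝ) :
    logNorm lam A r t = 1 / √((m : ℝ) * d) * Real.log
      (∫ v in Ioi (edge (symmAtomicLaw ρ)) ×ˢ Ioi (edge (symmAtomicLaw ρ)),
        Real.exp (-√((m : ℝ) * d) * (v.1 * r + v.2 * t - fkExp lam ρ v.1 v.2))) := by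
  have hq : 0 < √((m : ℝ) * d) := Real.sqrt_pos.2 (by positivity)
  rw [logNorm, lqNorm, quadrant, hA]
  set q := √((m : ℝ) * d)
  set e := edge (symmAtomicLaw ρ)
  have hae : (Ici e ×ˢ Ici e : Set (ℝ × ℝ)) =ᵐ[volume] Ioi e ×ˢ Ioi e :=
    Measure.set_prod_ae_eq Ioi_ae_eq_Ici.symm Ioi_ae_eq_Ici.symm
  rw [setIntegral_congr_set hae, setIntegral_congr_fun (measurableSet_Ioi.prod measurableSet_Ioi)
    (g := fun v : ℝ × ℝ => Real.exp (-q * (v.1 * r + v.2 * t - fkExp lam ρ v.1 v.2)))]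
  · set I := ∫ v in Ioi e ×ˢ Ioi e, Real.exp (-q * (v.1 * r + v.2 * t - fkExp lam ρ v.1 v.2))
    have hI : 0 ≤ I := integral_nonneg fun v => (Real.exp_pos _).le
    -- A zero integral, which is also the default value without integrability, gives `log 0 = 0` on
    -- both sides; the formula thus holds for all `r` and `t`.
    rcases hI.eq_or_lt with h | h
    · rw [← h, Real.zero_rpow (by positivity)]
      simp
    · rw [Real.log_rpow h]
  · intro v hv
    simp only
    rw [rectFK_eq hd hN hρ hA hv.1 hv.2, ← Real.exp_add, ← Real.exp_mul]
    congr 1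
    ring

instance neZero_restrict_Ioi_prod_Ioi (e : ℝ) :
    NeZero ((volume : Measure (ℝ × ℝ)).restrict (Ioi e ×ˢ Ioi e)) := by
  refine ⟨fun h => ?_⟩
  rw [Measure.restrict_eq_zero] at h
  exact ((isOpen_Ioi.prod isOpen_Ioi).measure_pos volume
    ⟨(e + 1, e + 1), by simp⟩).ne' h

lemma deriv_logNorm {m d : ℕ} {A : Matrix (Fin m) (Fin d) ℝ} (hlam1 : lam ≤ 1) (hm : 0 < m)
    (hd : 0 < d) (hN : 0 < N) (hρ : ∀ i, 0 ≤ ρ i) (hA : symmSingularLaw A = symmAtomicLaw ρ)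
    {r t : ℝ} (hr : 0 < r) (ht : 0 < t) :
    deriv (fun r => logNorm lam A r t) r =
      -((∫ v in Ioi (edge (symmAtomicLaw ρ)) ×ˢ Ioi (edge (symmAtomicLaw ρ)),
          v.1 * Real.exp (-√((m : ℝ) * d) * (v.1 * r + v.2 * t - fkExp lam ρ v.1 v.2))) /
        ∫ v in Ioi (edge (symmAtomicLaw ρ)) ×ˢ Ioi (edge (symmAtomicLaw ρ)),
          Real.exp (-√((m : ℝ) * d) * (v.1 * r + v.2 * t - fkExp lam ρ v.1 v.2))) ∧
    deriv (fun t => logNorm lam A r t) t =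
      -((∫ v in Ioi (edge (symmAtomicLaw ρ)) ×ˢ Ioi (edge (symmAtomicLaw ρ)),
          v.2 * Real.exp (-√((m : ℝ) * d) * (v.1 * r + v.2 * t - fkExp lam ρ v.1 v.2))) /
        ∫ v in Ioi (edge (symmAtomicLaw ρ)) ×ˢ Ioi (edge (symmAtomicLaw ρ)),
          Real.exp (-√((m : ℝ) * d) * (v.1 * r + v.2 * t - fkExp lam ρ v.1 v.2))) := by
  have hq : 0 < √((m : ℝ) * d) := Real.sqrt_pos.2 (by positivity)
  have h0 := edge_nonneg ρ hN
  have hint := fun {r t : ℝ} (hr : 0 < r) (ht : 0 < t) =>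
    integrableOn_exp_fkExp (lam := lam) hlam1 hN hρ hq hr ht
  simp only [logNorm_eq hm hd hN hρ hA]
  have hae := ae_restrict_mem (μ := (volume : Measure (ℝ × ℝ)))
    ((measurableSet_Ioi (a := edge (symmAtomicLaw ρ))).prod
      (measurableSet_Ioi (a := edge (symmAtomicLaw ρ))))
  constructor
  · simp only [add_sub_assoc] at hint ⊢
    refine (hasDerivAt_log_integral_exp measurable_fst.aestronglyMeasurable ?_ hq
      (fun r hr => hint hr ht) hr).deriv
    filter_upwards [hae] with v hv using h0.trans hv.1.le
  · have hc : ∀ (r t : ℝ) (v : ℝ × ℝ), v.1 * r + v.2 * t - fkExp lam ρ v.1 v.2 =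
        v.2 * t + (v.1 * r - fkExp lam ρ v.1 v.2) := fun _ _ _ => by ring
    simp only [hc] at hint ⊢
    refine (hasDerivAt_log_integral_exp measurable_snd.aestronglyMeasurable ?_ hq
      (fun t ht => hint hr ht) ht).deriv
    filter_upwards [hae] with v hv using h0.trans hv.2.le

lemma tendsto_gibbs_mean (hlam0 : 0 < lam) (hlam1 : lam ≤ 1) (hN : 0 < N) (hρ : ∀ i, 0 ≤ ρ i)
    {z r t : ℝ} (hz : edge (symmAtomicLaw ρ) < z)
    (hr : r = √lam * ((∑ i, z / (z * z - ρ i)) / N))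
    (ht : t = (1 - lam) / √lam * z⁻¹ + √lam * ((∑ i, z / (z * z - ρ i)) / N))
    (hr0 : 0 < r) (ht0 : 0 < t) {q : ℕ → ℝ} (hq : Tendsto q atTop atTop) {g : ℝ × ℝ → ℝ}
    (hg : ∀ q, 0 < q → IntegrableOn
      (fun v => g v * Real.exp (-q * (v.1 * r + v.2 * t - fkExp lam ρ v.1 v.2)))
      (Ioi (edge (symmAtomicLaw ρ)) ×ˢ Ioi (edge (symmAtomicLaw ρ))))
    (hgap : ∀ v : ℝ × ℝ, edge (symmAtomicLaw ρ) < v.1 → edge (symmAtomicLaw ρ) < v.2 →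
      0 < g v ∧ √lam * (g v / z - 1 - Real.log (g v / z)) ≤ fkGap lam ρ z v.1 v.2) :
    Tendsto (fun n => (∫ v in Ioi (edge (symmAtomicLaw ρ)) ×ˢ Ioi (edge (symmAtomicLaw ρ)),
          g v * Real.exp (-q n * (v.1 * r + v.2 * t - fkExp lam ρ v.1 v.2))) /
        ∫ v in Ioi (edge (symmAtomicLaw ρ)) ×ˢ Ioi (edge (symmAtomicLaw ρ)),
          Real.exp (-q n * (v.1 * r + v.2 * t - fkExp lam ρ v.1 v.2))) atTop (𝓝 z) := by
  have h0 := edge_nonneg ρ hN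
  have hz0 : 0 < z := h0.trans_lt hz
  have hE := fun {q : ℝ} (hq : 0 < q) =>
    integrableOn_exp_fkExp (lam := lam) hlam1 hN hρ hq hr0 ht0
  set e := edge (symmAtomicLaw ρ)
  -- As `(r, t)` is the gradient of `fkExp` at `(z, z)`, the phase is `c + fkGap`, and `e^{-qc}`
  -- cancels in the ratio.
  set c := z * r + z * t - fkExp lam ρ z z with hc
  have hsplit : ∀ (q : ℝ) (v : ℝ × ℝ),
      Real.exp (-q * (v.1 * r + v.2 * t - fkExp lam ρ v.1 v.2)) =
        Real.exp (-q * c) * Real.exp (-q * fkGap lam ρ z v.1 v.2) := fun q v => by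
    rw [← Real.exp_add, fkGap, ← ht, ← hr, hc]
    ring_nf
  simp only [hsplit, mul_left_comm (g _), integral_const_mul] at hg hE ⊢
  simp only [mul_div_mul_left _ _ (Real.exp_pos _).ne']
  have hunit : ∀ q : ℝ, IsUnit (Real.exp (-q * c)) := fun q => (Real.exp_pos _).ne'.isUnit
  refine tendsto_integral_mul_exp_div_integral_exp
    (Ψ := fun v : ℝ × ℝ => fkGap lam ρ z v.1 v.2)
    (fun q hq => (integrable_const_mul_iff (hunit q) _).1 (hE hq))
    (fun q hq => (integrable_const_mul_iff (hunit q) _).1 (hg q hq)) ?_ ?_ hq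
  · intro ε hε
    obtain ⟨m, hm, hτ⟩ := exists_le_sub_one_sub_log (div_pos hε hz0)
    refine ⟨√lam * m, mul_pos (Real.sqrt_pos.2 hlam0) hm, ?_⟩
    filter_upwards [ae_restrict_mem (measurableSet_Ioi.prod measurableSet_Ioi)] with v hv h
    obtain ⟨h1, h2⟩ := hgap v hv.1 hv.2
    refine le_trans (mul_le_mul_of_nonneg_left (hτ (g v / z) (by positivity) ?_)
      (Real.sqrt_nonneg _)) h2
    rw [div_sub_one hz0.ne', abs_div, abs_of_pos hz0]
    gcongr
  · intro η hη
    have hcont : ContinuousAt (fun v : ℝ × ℝ => fkGap lam ρ z v.1 v.2) (z, z) := by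
      have := continuousAt_fkExp (lam := lam) (ρ := ρ) (x := z) (y := z) hz0.ne'
        fun i => (mul_sub_pos_of_edge_lt hN hρ hz hz i).ne'
      unfold fkGap
      fun_prop
    have hzero : fkGap lam ρ z z z = 0 := by simp [fkGap]
    have hnhd : {v : ℝ × ℝ | fkGap lam ρ z v.1 v.2 ≤ η} ∩ Ioi e ×ˢ Ioi e ∈ 𝓝 (z, z) := by
      refine inter_mem ?_ ((isOpen_Ioi.prod isOpen_Ioi).mem_nhds ⟨hz, hz⟩)
      filter_upwards [hcont.eventually (gt_mem_nhds (show fkGap lam ρ z z z < η by rwa [hzero]))]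
        with v hv using hv.le
    rw [Measure.restrict_apply' (measurableSet_Ioi.prod measurableSet_Ioi)]
    exact (Measure.measure_pos_of_mem_nhds volume hnhd).ne'

/-! ### The gradient at `(z, z)` and the limit of `Q`. -/

lemma rPoint_eq {m d : ℕ} {A : Matrix (Fin m) (Fin d) ℝ} {s z : ℝ} (hd : 0 < d) (hN : 0 < N)
    (hρ : ∀ i, 0 ≤ ρ i) (hA : symmSingularLaw A = symmAtomicLaw ρ)
    (hz : edge (symmAtomicLaw ρ) < z) (hzs : zPoint lam A s = z) :
    rPoint lam A s = √lam * ((∑ i, z / (z * z - ρ i)) / N) := by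
  rw [rPoint, hzs]
  have h := (hasDerivAt_fkExp_left (lam := lam) z
    fun i => (mul_sub_pos_of_edge_lt hN hρ hz hz i).ne').neg
  rw [neg_eq_iff_eq_neg]
  refine (h.congr_of_eventuallyEq ?_).deriv
  filter_upwards [lt_mem_nhds hz] with x hx
  rw [fkPotential, rectFK_eq hd hN hρ hA hx hz, Real.log_exp]
  rfl

lemma tPoint_eq {m d : ℕ} {A : Matrix (Fin m) (Fin d) ℝ} {s z : ℝ} (hd : 0 < d) (hN : 0 < N)
    (hρ : ∀ i, 0 ≤ ρ i) (hA : symmSingularLaw A = symmAtomicLaw ρ)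
    (hz : edge (symmAtomicLaw ρ) < z) (hzs : zPoint lam A s = z) :
    tPoint lam A s = (1 - lam) / √lam * z⁻¹ + √lam * ((∑ i, z / (z * z - ρ i)) / N) := by
  have hz0 : 0 < z := (edge_nonneg ρ hN).trans_lt hz
  rw [tPoint, hzs]
  have h := (hasDerivAt_fkExp_right (lam := lam) z hz0.ne'
    fun i => (mul_sub_pos_of_edge_lt hN hρ hz hz i).ne').neg
  rw [neg_eq_iff_eq_neg]
  refine (h.congr_of_eventuallyEq ?_).deriv
  filter_upwards [lt_mem_nhds hz] with y hy
  rw [fkPotential, rectFK_eq hd hN hρ hA hz hy, Real.log_exp]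
  rfl

variable {m d : ℕ → ℕ} {A : ∀ n : ℕ, Matrix (Fin (m n)) (Fin (d n)) ℝ}

lemma tendsto_finiteQ (hlam0 : 0 < lam) (hlam1 : lam ≤ 1) (hN : 0 < N) (hρ : ∀ i, 0 ≤ ρ i)
    (hdim : ∀ n, (d n : ℝ) = lam * (m n : ℝ)) (hd : Tendsto d atTop atTop)
    (hA : ∀ᶠ n in atTop, symmSingularLaw (A n) = symmAtomicLaw ρ) {s : ℝ} (hs : 0 < s) :
    Tendsto (fun n => finiteQ lam (A n) s) atTop
      (𝓝 (rectCauchyInv lam (symmAtomicLaw ρ) (s ^ 2) ^ 2)) := by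
  have hz := (rectCauchyInv_spec hlam0 hlam1 hN hρ (pow_pos hs 2)).1
  set z := rectCauchyInv lam (symmAtomicLaw ρ) (s ^ 2) with hzdef
  have h0 := edge_nonneg ρ hN
  have hz0 : 0 < z := h0.trans_lt hz
  obtain ⟨r, hr⟩ : ∃ r, r = √lam * ((∑ i, z / (z * z - ρ i)) / N) := ⟨_, rfl⟩
  obtain ⟨t, ht⟩ : ∃ t, t = (1 - lam) / √lam * z⁻¹ + √lam * ((∑ i, z / (z * z - ρ i)) / N) :=
    ⟨_, rfl⟩
  have hr0 : 0 < r := by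
    have : Nonempty (Fin N) := ⟨⟨0, hN⟩⟩
    rw [hr]
    refine mul_pos (Real.sqrt_pos.2 hlam0) (div_pos (Finset.sum_pos (fun i _ =>
      div_pos hz0 (mul_sub_pos_of_edge_lt hN hρ hz hz i)) Finset.univ_nonempty) (by positivity))
  have ht0 : 0 < t := by
    rw [ht, ← hr]
    exact add_pos_of_nonneg_of_pos (mul_nonneg (div_nonneg (by linarith) (Real.sqrt_nonneg _))
      (inv_pos.2 hz0).le) hr0
  have hq : Tendsto (fun n => √((m n : ℝ) * d n)) atTop atTop := by
    have h : ∀ n, √((m n : ℝ) * d n) = (√lam)⁻¹ * d n := fun n => by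
      have : (m n : ℝ) * d n = lam⁻¹ * (d n : ℝ) ^ 2 := by
        rw [hdim n]
        field_simp
      rw [this, Real.sqrt_mul (by positivity), Real.sqrt_sq (by positivity), Real.sqrt_inv]
    simp only [h]
    exact (tendsto_natCast_atTop_atTop.comp hd).const_mul_atTop
      (inv_pos.2 (Real.sqrt_pos.2 hlam0))
  have hae := ae_restrict_mem (μ := (volume : Measure (ℝ × ℝ)))
    ((measurableSet_Ioi (a := edge (symmAtomicLaw ρ))).prod
      (measurableSet_Ioi (a := edge (symmAtomicLaw ρ))))
  have hint := fun {q r t : ℝ} (hq : 0 < q) (hr : 0 < r) (ht : 0 < t) =>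
    integrableOn_exp_fkExp (lam := lam) hlam1 hN hρ hq hr ht
  have l1 := tendsto_gibbs_mean hlam0 hlam1 hN hρ hz hr ht hr0 ht0 hq (g := Prod.fst)
    (fun q hq => by
      simp only [add_sub_assoc] at hint ⊢
      refine integrable_mul_exp_of_forall_integrable measurable_fst.aestronglyMeasurable ?_ hq
        (fun r hr => hint hq hr ht0) hr0
      filter_upwards [hae] with v hv using h0.trans hv.1.le)
    (fun v hv1 hv2 => ⟨h0.trans_lt hv1, le_fkGap_left hlam1 hN hρ hv1 hv2 hz⟩)
  have l2 := tendsto_gibbs_mean hlam0 hlam1 hN hρ hz hr ht hr0 ht0 hq (g := Prod.snd)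
    (fun q hq => by
      have hc : ∀ (r t : ℝ) (v : ℝ × ℝ), v.1 * r + v.2 * t - fkExp lam ρ v.1 v.2 =
        v.2 * t + (v.1 * r - fkExp lam ρ v.1 v.2) := fun _ _ _ => by ring
      simp only [hc] at hint ⊢
      refine integrable_mul_exp_of_forall_integrable measurable_snd.aestronglyMeasurable ?_ hq
        (fun t ht => hint hq hr0 ht) ht0
      filter_upwards [hae] with v hv using h0.trans hv.2.le)
    (fun v hv1 hv2 => ⟨h0.trans_lt hv2, le_fkGap_right hlam1 hN hρ hv1 hv2 hz⟩)
  have l := l1.neg.mul l2.neg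
  rw [neg_mul_neg, ← sq] at l
  refine l.congr' ?_
  filter_upwards [hA, hd.eventually_gt_atTop 0] with n hAn hdn
  have hmn : 0 < m n := by
    have h : (0 : ℝ) < lam * m n := hdim n ▸ Nat.cast_pos.2 hdn
    exact Nat.cast_pos.1 (pos_of_mul_pos_right h hlam0.le)
  have hzs : zPoint lam (A n) s = z := by rw [zPoint, hAn]
  rw [finiteQ, rPoint_eq hdn hN hρ hAn hz hzs, tPoint_eq hdn hN hρ hAn hz hzs, ← ht, ← hr,
    (deriv_logNorm hlam1 hmn hdn hN hρ hAn hr0 ht0).1,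
    (deriv_logNorm hlam1 hmn hdn hN hρ hAn hr0 ht0).2]

/-! ### From the limit of `Q` to the free transform. -/

/-- Since `(1-λ)² = (1+λ)² - 4λ`, the radicand of `K` is that of `U` up to the factor `(2λ)²`. -/
lemma sqrt_eq_sqrt_div (hlam0 : 0 < lam) (p : ℝ) :
    √(1 / lam * p + (1 - lam) ^ 2 / (4 * lam ^ 2)) =
      √((lam + 1) ^ 2 + 4 * lam * (p - 1)) / (2 * lam) := by
  have h : 1 / lam * p + (1 - lam) ^ 2 / (4 * lam ^ 2) =
      ((lam + 1) ^ 2 + 4 * lam * (p - 1)) / (2 * lam) ^ 2 := by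
    field_simp
    ring
  rw [h, Real.sqrt_div' _ (by positivity), Real.sqrt_sq (by positivity)]

/-- The law is prescribed only eventually so that zero matrices are covered: for `d = 0` their law
is the zero measure, not `δ₀`. -/
lemma tendsto_finiteK (hlam0 : 0 < lam) (hlam1 : lam ≤ 1) (hN : 0 < N) (hρ : ∀ i, 0 ≤ ρ i)
    (hdim : ∀ n, (d n : ℝ) = lam * (m n : ℝ)) (hd : Tendsto d atTop atTop)
    (hA : ∀ᶠ n in atTop, symmSingularLaw (A n) = symmAtomicLaw ρ) {s : ℝ} (hs : 0 < s) :
    Tendsto (fun n => finiteK lam (A n) s) atTop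
      (𝓝 (√((lam + 1) ^ 2 + 4 * lam *
        (rectP lam ρ (rectHInv lam (symmAtomicLaw ρ) (s ^ 2)) - 1)) / (2 * lam))) := by
  have hs2 : 0 < s ^ 2 := pow_pos hs 2
  obtain ⟨hz, hw⟩ := rectCauchyInv_spec hlam0 hlam1 hN hρ hs2
  obtain ⟨-, -, h2⟩ := rectHInv_spec hlam0 hN hρ hs2.le
  have hz0 := (edge_nonneg ρ hN).trans_lt hz
  have hP : rectP lam ρ (rectHInv lam (symmAtomicLaw ρ) (s ^ 2)) =
      s ^ 2 * rectCauchyInv lam (symmAtomicLaw ρ) (s ^ 2) ^ 2 := by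
    nth_rw 1 [hw] at h2
    field_simp at h2
    exact h2
  have hQ := tendsto_finiteQ hlam0 hlam1 hN hρ hdim hd hA hs
  rw [hP, ← sqrt_eq_sqrt_div hlam0, ← mul_assoc]
  exact ((hQ.const_mul _).add_const _).sqrt

lemma symmSingularLaw_zero {m d : ℕ} (hd : 0 < d) :
    symmSingularLaw (0 : Matrix (Fin m) (Fin d) ℝ) = symmAtomicLaw (fun _ : Fin 1 => (0 : ℝ)) := by
  have h : (Matrix.isHermitian_conjTranspose_mul_self
      (0 : Matrix (Fin m) (Fin d) ℝ)).eigenvalues = 0 := by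
    rw [Matrix.IsHermitian.eigenvalues_eq_zero_iff]
    simp
  have hd0 : (d : ENNReal) ≠ 0 := by exact_mod_cast hd.ne'
  rw [symmSingularLaw, symmAtomicLaw, h]
  simp only [Pi.zero_apply, Real.sqrt_zero, neg_zero, Finset.sum_const, Finset.card_univ,
    Fintype.card_fin, Nat.cast_one, mul_one, one_smul]
  rw [← Nat.cast_smul_eq_nsmul ENNReal, smul_smul,
    ENNReal.mul_inv (Or.inl two_ne_zero) (Or.inl ENNReal.ofNat_ne_top), mul_assoc,
    ENNReal.inv_mul_cancel hd0 (ENNReal.natCast_ne_top d), mul_one]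

lemma rectP_zero_atom {w : ℝ} : rectP lam (fun _ : Fin 1 => (0 : ℝ)) w = 1 := by
  simp [rectP, momentFn]

lemma tendsto_modifiedR (hlam0 : 0 < lam) (hlam1 : lam ≤ 1) (hN : 0 < N) (hρ : ∀ i, 0 ≤ ρ i)
    (hdim : ∀ n, (d n : ℝ) = lam * (m n : ℝ)) (hd : Tendsto d atTop atTop)
    (hA : ∀ n, symmSingularLaw (A n) = symmAtomicLaw ρ) {s : ℝ} (hs : 0 < s) :
    Tendsto (fun n => modifiedR lam (A n) s) atTop
      (𝓝 (rectR lam (symmAtomicLaw ρ) (s ^ 2))) := by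
  have h1 := tendsto_finiteK hlam0 hlam1 hN hρ hdim hd (Eventually.of_forall hA) hs
  have h2 := tendsto_finiteK (A := fun n => (0 : Matrix (Fin (m n)) (Fin (d n)) ℝ))
    hlam0 hlam1 one_pos (fun _ => le_rfl) hdim hd
    ((hd.eventually_gt_atTop 0).mono fun n hn => symmSingularLaw_zero hn) hs
  rw [rectP_zero_atom, sub_self, mul_zero, add_zero, Real.sqrt_sq (by positivity)] at h2
  rw [rectR_eq hlam0 hN hρ (pow_pos hs 2), rectU]
  convert! h1.sub h2 using 2
  ring

end Convergence

end

end RectFree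

theorem mainTheorem3 (lam : ℝ) (hlam_pos : 0 < lam) (hlam_le : lam ≤ 1)
    (μ : Measure ℝ) (m d : ℕ → ℕ)
    (A : ∀ n : ℕ, Matrix (Fin (m n)) (Fin (d n)) ℝ)
    (hdim : ∀ n, (d n : ℝ) = lam * (m n : ℝ))
    (hd : Tendsto d atTop atTop)
    (hlaw : ∀ n, RectFree.symmSingularLaw (A n) = μ) :
    ∃ a : ℕ → ℝ,
      (∀ᶠ x in 𝓝[>] (0 : ℝ), HasSum (fun k => a k * x ^ k) (RectFree.rectR lam μ x)) ∧
      ∀ s : ℝ, 0 < s → Summable (fun k => |a k * (s ^ 2) ^ k|) →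
        HasSum (fun k => a k * (s ^ 2) ^ k) (RectFree.rectR lam μ (s ^ 2)) ∧
        Tendsto (fun n => RectFree.modifiedR lam (A n) s) atTop
          (𝓝 (RectFree.rectR lam μ (s ^ 2))) := by
  obtain ⟨n₀, hn₀⟩ := (hd.eventually_gt_atTop 0).exists
  have hρ := (Matrix.posSemidef_conjTranspose_mul_self (A n₀)).eigenvalues_nonneg
  -- The singular values of one nonempty `A n₀` represent `μ` for all `n`.
  obtain rfl : RectFree.symmAtomicLaw
      (Matrix.isHermitian_conjTranspose_mul_self (A n₀)).eigenvalues = μ := hlaw n₀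
  obtain ⟨a, ha⟩ := RectFree.exists_hasSum_rectR hlam_pos hlam_le hn₀ hρ
  refine ⟨a, ha, fun s hs hsum => ⟨?_, ?_⟩⟩
  · exact RectFree.hasSum_of_summable_of_analyticOnNhd
      (fun x hx => RectFree.analyticAt_rectR hlam_pos hlam_le hn₀ hρ hx) ha (pow_pos hs 2) hsum
  · exact RectFree.tendsto_modifiedR hlam_pos hlam_le hn₀ hρ hdim hd hlaw hs
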